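/- For an integer $n\ge 1$, let $\mathcal{M}_n$ denote the set of all perfect matchings of the complete graph $K_{2n}$, so $|\mathcal{M}_n|=(2n-1)!!$ (with $(-1)!!=1$). For an edge $e$ of $K_{2n}$, the star centered at $e$ is $\mathcal{S}_e=\{M\in\mathcal{M}_n : e\in M\}$. For $S\subseteq\mathcal{M}_n$ let $\mathbf{1}_S:\mathcal{M}_n\to\mathbb{R}$ be its indicator function, and for $f:\mathcal{M}_n\to\mathbb{R}$ put $$\|f\|=\Big(\frac{1}{|\mathcal{M}_n|}\sum_{M\in\mathcal{M}_n} f(M)^2\Big)^{1/2}.$$ Let $U$ be the linear span of $\{\mathbf{1}_{\mathcal{S}_e} : e\in E(K_{2n})\}$, and let $\operatorname{Proj}_U$ be the orthogonal projection onto $U$. Let $\mathrm{round}(c)$ be the integer closest to $c$, rounding up in case of a tie, and let $\Delta$ denote symmetric difference. There exist absolute constants $C_0>0$ and $\varepsilon_0>0$ such that the following holds for all integers $n\ge 1$ and all real $\varepsilon$ with $0\le\varepsilon\le\varepsilon_0$. Let $A\subseteq\mathcal{M}_n$ be a set of size $|A|=c\,(2n-3)!!$, where $c\le\frac{2n-1}{2}$.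 If $$\|\mathbf{1}_A-\operatorname{Proj}_U(\mathbf{1}_A)\|^2\le \varepsilon\,\frac{c}{2n-1},$$ then there is a set $B$ that is a union of $\mathrm{round}(c)$ stars (centered at $\mathrm{round}(c)$ distinct edges of $K_{2n}$) such that $$|A\,\Delta\,B|\le C_0\,c^2\,(2n-3)!!\left(\sqrt{\varepsilon}+\frac{1}{2n-1}\right).$$ Moreover, $$|c-\mathrm{round}(c)|\le C_0\,c^2\left(\sqrt{\varepsilon}+\frac{1}{2n-1}\right).$$ -/

import Mathlib

open scoped Nat symmDiff

/-- The perfect matchings of the complete graph `K_{2n}`, that is, the vertices of the perfect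
matching graph. -/
abbrev PerfMatching (n : ℕ) : Type :=
  {M : (⊤ : SimpleGraph (Fin (2 * n))).Subgraph // M.IsPerfectMatching}

/-- The edges of the complete graph `K_{2n}`. -/
abbrev KEdge (n : ℕ) : Type := ↥((⊤ : SimpleGraph (Fin (2 * n))).edgeSet)

noncomputable instance instFintypePerfMatching (n : ℕ) : Fintype (PerfMatching n) :=
  Fintype.ofFinite _

/-- The star centered at `e`: all perfect matchings that contain the edge `e`. -/
def pmStar (n : ℕ) (e : KEdge n) : Set (PerfMatching n) :=
  {M | (e : Sym2 (Fin (2 * n))) ∈ M.1.edgeSet}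

/-- The indicator function of a set of perfect matchings, as a real vector. -/
noncomputable def indicatorVec {n : ℕ} (S : Set (PerfMatching n)) :
    EuclideanSpace ℝ (PerfMatching n) :=
  WithLp.toLp 2 (S.indicator 1)

/-- The linear span of the indicator functions of the stars. -/
noncomputable def starSpan (n : ℕ) : Submodule ℝ (EuclideanSpace ℝ (PerfMatching n)) :=
  Submodule.span ℝ (Set.range fun e : KEdge n => indicatorVec (pmStar n e))

/-- The normalized norm `‖f‖ = (|V|⁻¹ ∑ v, f v ^ 2) ^ (1/2)`. It is a constant multiple of the
Euclidean norm, so both give the same orthogonal projections. -/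
noncomputable def normalizedNorm {n : ℕ} (f : EuclideanSpace ℝ (PerfMatching n)) : ℝ :=
  Real.sqrt ((1 / (Fintype.card (PerfMatching n) : ℝ)) * ∑ M, f M ^ 2)

/-- Fixed-point-free involutions of `V`, that is, perfect matchings of the complete graph on `V`. -/
abbrev FPFInv (V : Type*) : Type _ :=
  {π : Equiv.Perm V // (∀ v, π (π v) = v) ∧ ∀ v, π v ≠ v}

noncomputable instance instFintypeFPFInv (V : Type*) [Finite V] : Fintype (FPFInv V) :=
  Fintype.ofFinite _

namespace FPFInv

variable {V : Type*}

/-- Conjugation of a fixed-point-free involution by a permutation. -/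
def conj (σ : Equiv.Perm V) : FPFInv V ≃ FPFInv V where
  toFun π := ⟨σ * π.1 * σ⁻¹, by
    refine ⟨fun v => by simp [π.2.1], fun v h => ?_⟩
    exact π.2.2 (σ⁻¹ v) (σ.injective (by simpa using h))⟩
  invFun π := ⟨σ⁻¹ * π.1 * σ, by
    refine ⟨fun v => by simp [π.2.1], fun v h => ?_⟩
    refine π.2.2 (σ v) (σ⁻¹.injective (by simpa using h))⟩
  left_inv π := Subtype.ext (by simp [mul_assoc])
  right_inv π := Subtype.ext (by simp [mul_assoc])

lemma conj_apply (σ : Equiv.Perm V) (π : FPFInv V) (v : V) :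
    (conj σ π).1 v = σ (π.1 (σ⁻¹ v)) := rfl

lemma apply_eq_iff (π : FPFInv V) {a b : V} : π.1 a = b ↔ π.1 b = a :=
  ⟨fun h => by rw [← h, π.2.1], fun h => by rw [← h, π.2.1]⟩

variable [DecidableEq V]

lemma conj_swap_apply (π : FPFInv V) (u v x : V) :
    (conj (Equiv.swap u v) π).1 x = Equiv.swap u v (π.1 (Equiv.swap u v x)) := by
  rw [conj_apply, Equiv.swap_inv]

lemma conj_swap_conj_swap (π : FPFInv V) (u v : V) :
    conj (Equiv.swap u v) (conj (Equiv.swap u v) π) = π :=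
  Subtype.ext (Equiv.ext fun x => by simp [conj_swap_apply])

/-- Indicator that `π` matches `a` with `b`. -/
def ind (a b : V) (π : FPFInv V) : ℝ := if π.1 a = b then 1 else 0

lemma ind_comm (a b : V) (π : FPFInv V) : ind a b π = ind b a π := by
  simp only [ind, π.apply_eq_iff (a := a)]

lemma ind_self (a : V) (π : FPFInv V) : ind a a π = 0 := by
  simp [ind, π.2.2]

lemma ind_nonneg (a b : V) (π : FPFInv V) : 0 ≤ ind a b π := by
  unfold ind; split_ifs <;> simp

lemma ind_conj_swap (π : FPFInv V) (u v a b : V) :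
    ind a b (conj (Equiv.swap u v) π) = ind (Equiv.swap u v a) (Equiv.swap u v b) π := by
  unfold ind
  rw [conj_swap_apply]
  congr 1
  rw [eq_iff_iff]
  constructor
  · intro h; rw [← h, Equiv.swap_apply_self]
  · intro h; rw [h, Equiv.swap_apply_self]

variable [Fintype V]

lemma sum_ind_mul (π : FPFInv V) (a : V) (F : V → ℝ) : ∑ b, ind a b π * F b = F (π.1 a) := by
  simp [ind]

/-- If `g` is supported where `π c ∈ D` and is invariant under swaps inside `D`, then the mass of
`g` is equidistributed among the values `π c = d`, `d ∈ D`. -/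
lemma card_mul_sum_mul_ind (g : FPFInv V → ℝ) (D : Finset V) (c : V) (hc : c ∉ D)
    (hsupp : ∀ π, g π ≠ 0 → π.1 c ∈ D)
    (hinv : ∀ d ∈ D, ∀ d' ∈ D, ∀ π, g (conj (Equiv.swap d d') π) = g π) (d : V) (hd : d ∈ D) :
    (D.card : ℝ) * ∑ π, g π * ind c d π = ∑ π, g π := by
  have h1 : ∀ d' ∈ D, ∑ π, g π * ind c d' π = ∑ π, g π * ind c d π := by
    intro d' hd'
    rw [← Equiv.sum_comp (conj (Equiv.swap d d'))]
    refine Finset.sum_congr rfl fun π _ => ?_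
    rw [hinv d hd d' hd', ind_conj_swap, Equiv.swap_apply_right,
      Equiv.swap_apply_of_ne_of_ne (by rintro rfl; exact hc hd) (by rintro rfl; exact hc hd')]
  calc (D.card : ℝ) * ∑ π, g π * ind c d π = ∑ d' ∈ D, ∑ π, g π * ind c d' π := by
        rw [Finset.sum_congr rfl h1]; simp
    _ = ∑ π, ∑ d' ∈ D, g π * ind c d' π := Finset.sum_comm
    _ = ∑ π, g π := by
        refine Finset.sum_congr rfl fun π _ => ?_
        by_cases h : g π = 0
        · simp [h]
        · rw [← Finset.mul_sum]; simp [ind, hsupp π h]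

lemma card_mul_sum_ind {N : ℝ} (hN : (Fintype.card V : ℝ) = N + 1) {a b : V} (hab : a ≠ b) :
    N * ∑ π, ind a b π = Fintype.card (FPFInv V) := by
  have h := card_mul_sum_mul_ind (V := V) (fun _ => 1) (Finset.univ.erase a) a (by simp)
    (fun π _ => by simp [π.2.2]) (by simp) b (by simp [hab.symm])
  rw [Finset.card_erase_of_mem (Finset.mem_univ a), Nat.cast_sub
    (Finset.card_pos.2 ⟨a, Finset.mem_univ a⟩), Finset.card_univ, hN] at h
  simpa using h

lemma sum_ind {N w : ℝ} (hN : (Fintype.card V : ℝ) = N + 1) (hN0 : N ≠ 0)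
    (hw : (Fintype.card (FPFInv V) : ℝ) = N * w) {a b : V} (hab : a ≠ b) :
    ∑ π, ind a b π = w :=
  mul_left_cancel₀ hN0 (by rw [card_mul_sum_ind hN hab, hw])

lemma sum_ind_mul_ind {N w : ℝ} (hN : (Fintype.card V : ℝ) = N + 1) (hN2 : 2 < N)
    (hw : (Fintype.card (FPFInv V) : ℝ) = N * w) {a b c d : V} (hab : a ≠ b) (hac : a ≠ c)
    (had : a ≠ d) (hbc : b ≠ c) (hbd : b ≠ d) (hcd : c ≠ d) :
    ∑ π, ind a b π * ind c d π = w / (N - 2) := by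
  have hcard : ((Finset.univ \ {a, b, c} : Finset V).card : ℝ) = N - 2 := by
    have h3 : ({a, b, c} : Finset V).card = 3 := by simp [*]
    rw [Finset.card_sdiff_of_subset (Finset.subset_univ _), h3, Nat.cast_sub, Finset.card_univ, hN]
    · push_cast; ring
    · rw [← h3]; exact Finset.card_le_card (Finset.subset_univ _)
  have h := card_mul_sum_mul_ind (V := V) (ind a b) (Finset.univ \ {a, b, c}) c (by simp)
    (fun π hπ => by
      have hπ : π.1 a = b := by by_contra h; exact hπ (by simp [ind, h])
      have h' : π.1 b = a := π.apply_eq_iff.1 hπ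
      simp only [Finset.mem_sdiff, Finset.mem_univ, Finset.mem_insert, Finset.mem_singleton,
        true_and, not_or]
      refine ⟨fun h => hbc ?_, fun h => hac ?_, π.2.2 c⟩
      · rw [← hπ, π.apply_eq_iff.1 h]
      · rw [← h', π.apply_eq_iff.1 h])
    (fun e he e' he' π => by
      simp only [Finset.mem_sdiff, Finset.mem_univ, Finset.mem_insert, Finset.mem_singleton,
        true_and, not_or] at he he'
      rw [ind_conj_swap, Equiv.swap_apply_of_ne_of_ne (Ne.symm he.1) (Ne.symm he'.1),
        Equiv.swap_apply_of_ne_of_ne (Ne.symm he.2.1) (Ne.symm he'.2.1)])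
    d (by simp [had.symm, hbd.symm, hcd.symm])
  rw [hcard, sum_ind hN (by linarith) hw hab] at h
  rw [eq_div_iff (by linarith), mul_comm]; exact h

/-- The number of fixed-point-free involutions on `2n` points. -/
lemma card_eq_doubleFactorial (n : ℕ) (hV : Fintype.card V = 2 * n) :
    Fintype.card (FPFInv V) = (2 * n - 1)‼ := by
  have h1 : ∀ π : Equiv.Perm V, ((∀ v, π (π v) = v) ∧ ∀ v, π v ≠ v) ↔
      π.cycleType = Multiset.replicate n 2 := by
    intro π
    constructor
    · rintro ⟨h1, h2⟩
      have h3 : π ^ 2 = 1 := Equiv.ext fun v => by simp [pow_two, h1]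
      have : Fact (Nat.Prime 2) := ⟨Nat.prime_two⟩
      have h4 := Equiv.Perm.cycleType_of_pow_prime_eq_one h3
      have h5 := π.sum_cycleType
      have h6 : π.support = Finset.univ := by ext v; simp [h2]
      rw [h4, h6, Finset.card_univ, hV] at h5
      simp only [Multiset.sum_replicate, smul_eq_mul] at h5
      rw [h4]; congr 1; omega
    · intro h
      have h5 := π.sum_cycleType
      rw [h] at h5
      simp only [Multiset.sum_replicate, smul_eq_mul] at h5
      have h6 : π.support = Finset.univ := by
        rw [← Finset.card_eq_iff_eq_univ]; omega
      have h7 : orderOf π ∣ 2 := by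
        rw [← Equiv.Perm.lcm_cycleType, h, Multiset.lcm_dvd]
        intro b hb; rw [Multiset.eq_of_mem_replicate hb]
      have h8 := orderOf_dvd_iff_pow_eq_one.1 h7
      refine ⟨fun v => ?_, fun v => ?_⟩
      · have := Equiv.ext_iff.1 h8 v; simpa [pow_two] using this
      · have : v ∈ π.support := by rw [h6]; simp
        simpa using this
  have h2 : Fintype.card (FPFInv V) =
      ({g | g.cycleType = Multiset.replicate n 2} : Finset (Equiv.Perm V)).card := by
    rw [← Nat.card_eq_fintype_card, Nat.card_congr (Equiv.subtypeEquivRight h1),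
      Nat.card_eq_fintype_card, Fintype.card_subtype]
  have h3 := Equiv.Perm.card_of_cycleType_mul_eq V (Multiset.replicate n 2)
  rw [← h2, hV] at h3
  have h4 : ∏ k ∈ (Multiset.replicate n 2).toFinset, ((Multiset.replicate n 2).count k)! = n ! := by
    rcases Nat.eq_zero_or_pos n with rfl | hn
    · simp
    · rw [Multiset.toFinset_replicate, if_neg hn.ne']; simp
  rw [h4, if_pos ⟨by simp [mul_comm], fun a ha => by rw [Multiset.eq_of_mem_replicate ha]⟩] at h3
  simp only [Multiset.sum_replicate, smul_eq_mul, Multiset.prod_replicate, mul_comm n 2,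
    Nat.sub_self, Nat.factorial_zero, one_mul] at h3
  rcases Nat.eq_zero_or_pos n with rfl | hn
  · simpa using h3
  · have h5 := Nat.factorial_eq_mul_doubleFactorial (2 * n - 1)
    rw [show 2 * n - 1 + 1 = 2 * n by omega, Nat.doubleFactorial_two_mul] at h5
    rw [h5, mul_comm] at h3
    exact Nat.eq_of_mul_eq_mul_left (by positivity) h3

end FPFInv

namespace FPFInv

variable {V : Type*} [Fintype V]

/-- The total weight of the edges of the matching `π` for a symmetric weight function `F`. -/
noncomputable def weight (F : V → V → ℝ) (π : FPFInv V) : ℝ := (1 / 2) * ∑ u, F u (π.1 u)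

lemma weight_nonneg {F : V → V → ℝ} (hF : ∀ a b, 0 ≤ F a b) (π : FPFInv V) : 0 ≤ weight F π :=
  mul_nonneg (by norm_num) (Finset.sum_nonneg fun _ _ => hF _ _)

lemma sum_apply_comp (π : FPFInv V) (F : V → ℝ) : ∑ v, F (π.1 v) = ∑ v, F v :=
  Equiv.sum_comp π.1 F

lemma sum_apply (F : V → V → ℝ) (π : FPFInv V) : ∑ u, F u (π.1 u) = 2 * weight F π := by
  unfold weight; ring

variable [DecidableEq V]

lemma weight_conj_swap_sub {F : V → V → ℝ} (hs : ∀ a b, F a b = F b a) (hd : ∀ a, F a a = 0)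
    (π : FPFInv V) (u v : V) :
    weight F (conj (Equiv.swap u v) π) - weight F π =
      F u (π.1 v) + F v (π.1 u) - F u (π.1 u) - F v (π.1 v)
        + if v = π.1 u then 2 * F u (π.1 u) else 0 := by
  have h0 : weight F (conj (Equiv.swap u v) π) - weight F π = (1 / 2) * ∑ y,
      (F (Equiv.swap u v y) (Equiv.swap u v (π.1 y)) - F y (π.1 y)) := by
    unfold weight
    rw [← mul_sub, Finset.sum_sub_distrib, ← Equiv.sum_comp (Equiv.swap u v)]
    simp [conj_swap_apply]
  rw [h0]
  by_cases huv : u = v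
  · subst huv
    simp [(π.2.2 u).symm]
  by_cases hv : v = π.1 u
  · subst hv
    rw [Finset.sum_eq_zero]
    · simp [π.2.1, hd, hs (π.1 u) u]; ring
    intro y _
    by_cases h1 : y = u
    · subst h1; simp [hs]
    by_cases h2 : y = π.1 u
    · subst h2; simp [π.2.1, hs]
    have h3 : π.1 y ≠ u := fun h => h2 (π.apply_eq_iff.1 h).symm
    have h4 : π.1 y ≠ π.1 u := fun h => h1 (π.1.injective h)
    simp [Equiv.swap_apply_of_ne_of_ne, h1, h2, h3, h4]
  · have hu : u ≠ π.1 v := fun h => hv (π.apply_eq_iff.1 h.symm).symm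
    have hvu : π.1 u ≠ π.1 v := fun h => huv (π.1.injective h)
    have e1 := π.2.2 u
    have e2 := π.2.2 v
    rw [← Finset.sum_subset (Finset.subset_univ {u, v, π.1 u, π.1 v})]
    · rw [Finset.sum_insert, Finset.sum_insert, Finset.sum_insert, Finset.sum_singleton, if_neg hv]
      · simp [π.2.1, Equiv.swap_apply_of_ne_of_ne, e1, e2, hu.symm, Ne.symm hv]
        rw [hs (π.1 u), hs (π.1 v), hs (π.1 u), hs (π.1 v)]; ring
      · simp [hvu]
      · simp [hv, e2.symm]
      · simp [huv, hu, e1.symm]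
    · intro y _ hy
      simp only [Finset.mem_insert, Finset.mem_singleton, not_or] at hy
      obtain ⟨y1, y2, y3, y4⟩ := hy
      have z1 : π.1 y ≠ u := fun h => y3 (π.apply_eq_iff.1 h).symm
      have z2 : π.1 y ≠ v := fun h => y4 (π.apply_eq_iff.1 h).symm
      simp [Equiv.swap_apply_of_ne_of_ne, y1, y2, z1, z2]

section Stein

variable {N : ℝ} {Q : V → V → ℝ}

/-- A weight function with vanishing row sums is an eigenfunction of the switching walk. -/
lemma sum_sub_weight_conj_swap (hN : (Fintype.card V : ℝ) = N + 1) (hs : ∀ a b, Q a b = Q b a)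
    (hd : ∀ a, Q a a = 0) (hr : ∀ a, ∑ b, Q a b = 0) (π : FPFInv V) :
    ∑ u, ∑ v, (weight Q π - weight Q (conj (Equiv.swap u v) π)) = 4 * N * weight Q π := by
  have h : ∀ u, ∑ v, (weight Q π - weight Q (conj (Equiv.swap u v) π)) =
      (N - 1) * Q u (π.1 u) + 2 * weight Q π := by
    intro u
    have h1 : ∀ v, weight Q π - weight Q (conj (Equiv.swap u v) π) =
      -Q u (π.1 v) - Q (π.1 u) v + Q u (π.1 u) + Q v (π.1 v)
        - if v = π.1 u then 2 * Q u (π.1 u) else 0 := by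
      intro v
      have := weight_conj_swap_sub hs hd π u v
      rw [hs (π.1 u)]
      linarith
    simp_rw [h1]
    rw [Finset.sum_sub_distrib, Finset.sum_add_distrib, Finset.sum_add_distrib,
      Finset.sum_sub_distrib, Finset.sum_neg_distrib, sum_apply_comp π (Q u), hr, hr, sum_apply]
    simp [hN]; ring
  simp_rw [h]
  rw [Finset.sum_add_distrib, ← Finset.mul_sum, sum_apply]
  simp [hN]; ring

lemma sum_sq_sub_weight_conj_swap_le (hN : (Fintype.card V : ℝ) = N + 1)
    (hs : ∀ a b, Q a b = Q b a)
    (hd : ∀ a, Q a a = 0) (hr : ∀ a, ∑ b, Q a b = 0) (π : FPFInv V) :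
    ∑ u, ∑ v, (weight Q π - weight Q (conj (Equiv.swap u v) π)) ^ 2 ≤
      4 * (N - 1) * weight (fun a b => Q a b ^ 2) π + 4 * ∑ a, ∑ b, Q a b ^ 2
        + 8 * weight Q π ^ 2 := by
  have h : ∀ u, ∑ v, (weight Q π - weight Q (conj (Equiv.swap u v) π)) ^ 2 ≤
      2 * ∑ b, Q u b ^ 2 + 2 * ∑ b, Q (π.1 u) b ^ 2 + (N - 3) * Q u (π.1 u) ^ 2
        + 2 * weight (fun a b => Q a b ^ 2) π + 4 * Q u (π.1 u) * weight Q π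
        - 2 * ∑ v, Q (π.1 v) u * Q v (π.1 v) - 2 * ∑ v, Q v (π.1 u) * Q v (π.1 v) := by
    intro u
    have h1 : ∀ v, (weight Q π - weight Q (conj (Equiv.swap u v) π)) ^ 2 ≤
      2 * Q u (π.1 v) ^ 2 + 2 * Q (π.1 u) v ^ 2 + Q u (π.1 u) ^ 2 + Q v (π.1 v) ^ 2
        + 2 * Q u (π.1 u) * Q v (π.1 v) - 2 * Q u (π.1 u) * Q u (π.1 v)
        - 2 * Q u (π.1 u) * Q (π.1 u) v - 2 * (Q (π.1 v) u * Q v (π.1 v))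
        - 2 * (Q v (π.1 u) * Q v (π.1 v)) - if v = π.1 u then 4 * Q u (π.1 u) ^ 2 else 0 := by
      intro v
      have := weight_conj_swap_sub hs hd π u v
      rw [hs (π.1 u), hs (π.1 v) u]
      rw [← neg_sub, this]
      split_ifs with hv
      · subst hv
        simp only [π.2.1, hd, hs (π.1 u) u]
        nlinarith
      · nlinarith [sq_nonneg (Q u (π.1 v) - Q v (π.1 u))]
    refine (Finset.sum_le_sum fun v _ => h1 v).trans_eq ?_
    simp only [Finset.sum_sub_distrib, Finset.sum_add_distrib, ← Finset.mul_sum]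
    rw [sum_apply_comp π (Q u), hr, hr, sum_apply_comp π (fun b => Q u b ^ 2), sum_apply Q,
      sum_apply (fun a b => Q a b ^ 2)]
    simp [hN]; ring
  refine (Finset.sum_le_sum fun u _ => h u).trans_eq ?_
  have c1 : ∑ u, ∑ v, Q (π.1 v) u * Q v (π.1 v) = 0 := by
    rw [Finset.sum_comm]; simp [← Finset.sum_mul, hr]
  have c2 : ∑ u, ∑ v, Q v (π.1 u) * Q v (π.1 v) = 0 := by
    rw [Finset.sum_comm]
    refine Finset.sum_eq_zero fun v _ => ?_
    rw [← Finset.sum_mul, sum_apply_comp π (Q v), hr, zero_mul]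
  simp only [Finset.sum_sub_distrib, Finset.sum_add_distrib, ← Finset.mul_sum, ← Finset.sum_mul]
  rw [c1, c2, sum_apply_comp π (fun u => ∑ b, Q u b ^ 2), sum_apply Q,
      sum_apply (fun a b => Q a b ^ 2)]
  simp [hN]; ring

lemma sq_posPart_sub_mul_sub_le (x y : ℝ) :
    (max x 0 ^ 2 - max y 0 ^ 2) * (x - y) ≤ (max x 0 + max y 0) * (x - y) ^ 2 := by
  have h : (max x 0 - max y 0) * (x - y) ≤ (x - y) ^ 2 := by
    rcases le_total x 0 with hx | hx <;> rcases le_total y 0 with hy | hy <;>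
      simp only [max_eq_left, max_eq_right, hx, hy] <;> nlinarith
  have h2 : 0 ≤ max x 0 + max y 0 := by positivity
  calc _ = (max x 0 + max y 0) * ((max x 0 - max y 0) * (x - y)) := by ring
    _ ≤ _ := mul_le_mul_of_nonneg_left h h2

lemma sum_posPart_cube_le (hN : (Fintype.card V : ℝ) = N + 1) (hs : ∀ a b, Q a b = Q b a)
    (hd : ∀ a, Q a a = 0) (hr : ∀ a, ∑ b, Q a b = 0) :
    (N - 2) * ∑ π : FPFInv V, max (weight Q π) 0 ^ 3 ≤
      (N - 1) * ∑ π : FPFInv V, max (weight Q π) 0 * weight (fun a b => Q a b ^ 2) π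
        + (∑ a, ∑ b, Q a b ^ 2) * ∑ π : FPFInv V, max (weight Q π) 0 := by
  set Y : FPFInv V → ℝ := weight Q
  set Y' : V → V → FPFInv V → ℝ := fun u v π => Y (conj (Equiv.swap u v) π)
  have hsymm : ∀ (u v : V) (H : ℝ → ℝ → ℝ), ∑ π, H (Y π) (Y' u v π) = ∑ π, H (Y' u v π) (Y π) := by
    intro u v H
    rw [← Equiv.sum_comp (conj (Equiv.swap u v))]
    simp [Y', conj_swap_conj_swap]
  have hcube : ∀ x : ℝ, max x 0 ^ 2 * x = max x 0 ^ 3 := fun x => by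
    rcases le_total x 0 with hx | hx <;> simp [hx]; ring
  have hcube' : ∀ x : ℝ, max x 0 * x ^ 2 = max x 0 ^ 3 := fun x => by
    rcases le_total x 0 with hx | hx <;> simp [hx]; ring
  have e1 : 4 * N * ∑ π, max (Y π) 0 ^ 3 = ∑ u, ∑ v, ∑ π, max (Y π) 0 ^ 2 * (Y π - Y' u v π) := by
    calc _ = ∑ π, max (Y π) 0 ^ 2 * ∑ u, ∑ v, (Y π - Y' u v π) := by
          rw [Finset.mul_sum]
          refine Finset.sum_congr rfl fun π _ => ?_
          rw [sum_sub_weight_conj_swap hN hs hd hr π, ← hcube]; ring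
      _ = ∑ π, ∑ u, ∑ v, max (Y π) 0 ^ 2 * (Y π - Y' u v π) := by simp only [Finset.mul_sum]
      _ = _ := by
          rw [Finset.sum_comm]
          exact Finset.sum_congr rfl fun u _ => Finset.sum_comm
  have e2 : ∀ u v, ∑ π, max (Y π) 0 ^ 2 * (Y π - Y' u v π) ≤
      ∑ π, max (Y π) 0 * (Y π - Y' u v π) ^ 2 := by
    intro u v
    have a1 := hsymm u v (fun x y => max x 0 ^ 2 * (x - y))
    have a2 := hsymm u v (fun x y => max x 0 * (x - y) ^ 2)
    have a3 : ∑ π, (max (Y π) 0 ^ 2 * (Y π - Y' u v π) + max (Y' u v π) 0 ^ 2 * (Y' u v π - Y π)) ≤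
      ∑ π, (max (Y π) 0 * (Y π - Y' u v π) ^ 2 + max (Y' u v π) 0 * (Y' u v π - Y π) ^ 2) := by
      refine Finset.sum_le_sum fun π _ => ?_
      have := sq_posPart_sub_mul_sub_le (Y π) (Y' u v π)
      linarith
    rw [Finset.sum_add_distrib, Finset.sum_add_distrib] at a3
    linarith
  have e3 : ∑ u, ∑ v, ∑ π, max (Y π) 0 * (Y π - Y' u v π) ^ 2 ≤
      ∑ π, max (Y π) 0 * (4 * (N - 1) * weight (fun a b => Q a b ^ 2) π
        + 4 * ∑ a, ∑ b, Q a b ^ 2 + 8 * Y π ^ 2) := by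
    calc _ = ∑ π, max (Y π) 0 * ∑ u, ∑ v, (Y π - Y' u v π) ^ 2 := by
          simp only [Finset.mul_sum]
          rw [Finset.sum_comm]
          refine (Finset.sum_congr rfl fun u _ => Finset.sum_comm).trans ?_
          rw [Finset.sum_comm]
          refine (Finset.sum_congr rfl fun π _ => ?_)
          rw [Finset.sum_comm]
      _ ≤ _ := Finset.sum_le_sum fun π _ => mul_le_mul_of_nonneg_left
          (sum_sq_sub_weight_conj_swap_le hN hs hd hr π) (le_max_right _ _)
  have e4 : ∑ π, max (Y π) 0 * (4 * (N - 1) * weight (fun a b => Q a b ^ 2) π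
        + 4 * ∑ a, ∑ b, Q a b ^ 2 + 8 * Y π ^ 2) =
      4 * (N - 1) * ∑ π, max (Y π) 0 * weight (fun a b => Q a b ^ 2) π
        + 4 * (∑ a, ∑ b, Q a b ^ 2) * ∑ π, max (Y π) 0 + 8 * ∑ π, max (Y π) 0 ^ 3 := by
    simp only [← hcube', Finset.mul_sum, ← Finset.sum_add_distrib]
    refine Finset.sum_congr rfl fun π _ => ?_
    simp only [← Finset.mul_sum]
    ring
  have e5 := Finset.sum_le_sum fun u (_ : u ∈ Finset.univ) =>
    Finset.sum_le_sum fun v (_ : v ∈ Finset.univ) => e2 u v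
  linarith

end Stein

end FPFInv

namespace FPFInv

variable {V : Type*} [Fintype V] [DecidableEq V]

lemma sum_mul_apply (g : FPFInv V → ℝ) (F : V → V → ℝ) (v : V) :
    ∑ π, g π * F v (π.1 v) = ∑ b, F v b * ∑ π, g π * ind v b π := by
  simp only [Finset.mul_sum]
  rw [Finset.sum_comm]
  refine Finset.sum_congr rfl fun π _ => ?_
  rw [← sum_ind_mul π v (F v), Finset.mul_sum]
  exact Finset.sum_congr rfl fun b _ => by ring

lemma sum_mul_weight_eq_sum_apply {V : Type*} [Fintype V] (g : FPFInv V → ℝ) (F : V → V → ℝ) :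
    ∑ π, g π * weight F π = (1 / 2) * ∑ u, ∑ π, g π * F u (π.1 u) := by
  rw [Finset.sum_comm, Finset.mul_sum]
  refine Finset.sum_congr rfl fun π _ => ?_
  rw [weight, ← Finset.mul_sum]; ring

lemma sum_mul_weight (g : FPFInv V → ℝ) (F : V → V → ℝ) :
    ∑ π, g π * weight F π = (1 / 2) * ∑ u, ∑ b, F u b * ∑ π, g π * ind u b π := by
  rw [sum_mul_weight_eq_sum_apply]
  simp only [sum_mul_apply]

lemma ind_mul_ind_of_ne {V : Type*} [DecidableEq V] (π : FPFInv V) (u : V) {a b : V} (h : a ≠ b) :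
    ind u a π * ind u b π = 0 := by
  unfold ind
  split_ifs with h1 h2 <;> simp
  exact h (h1.symm.trans h2)

lemma sum_ind_mul_apply_left (u a : V) (F : V → V → ℝ) :
    ∑ π, ind u a π * F u (π.1 u) = F u a * ∑ π, ind u a π := by
  rw [Finset.mul_sum]
  refine Finset.sum_congr rfl fun π _ => ?_
  unfold ind
  split_ifs with h
  · rw [h]; ring
  · simp

section Moments

variable {N w : ℝ}

lemma sum_weight (hN : (Fintype.card V : ℝ) = N + 1) (hN0 : N ≠ 0)
    (hw : (Fintype.card (FPFInv V) : ℝ) = N * w) {F : V → V → ℝ} (hd : ∀ a, F a a = 0) :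
    ∑ π, weight F π = w * ((1 / 2) * ∑ a, ∑ b, F a b) := by
  have h := sum_mul_weight (fun _ => (1 : ℝ)) F
  simp only [one_mul] at h
  rw [h, mul_left_comm]
  congr 1
  rw [Finset.mul_sum]
  refine Finset.sum_congr rfl fun u _ => ?_
  rw [Finset.mul_sum]
  refine Finset.sum_congr rfl fun b _ => ?_
  by_cases hub : u = b
  · subst hub; simp [hd]
  · rw [sum_ind hN hN0 hw hub, mul_comm]

lemma sum_ind_mul_apply (hN : (Fintype.card V : ℝ) = N + 1) (hN2 : 2 < N)
    (hw : (Fintype.card (FPFInv V) : ℝ) = N * w)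
    {Q : V → V → ℝ}
    (hd : ∀ a, Q a a = 0) (hr : ∀ a, ∑ b, Q a b = 0) {u a v : V} (hua : u ≠ a) (hvu : v ≠ u)
    (hva : v ≠ a) :
    ∑ π, ind u a π * Q v (π.1 v) = -(w / (N - 2)) * (Q v u + Q v a) := by
  have h : ∀ b, Q v b * ∑ π, ind u a π * ind v b π = (w / (N - 2)) * Q v b
      - (if b = u then (w / (N - 2)) * Q v u else 0)
      - (if b = a then (w / (N - 2)) * Q v a else 0) := by
    intro b
    by_cases h1 : b = u
    · subst h1
      simp only [if_pos, if_neg hua]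
      rw [Finset.sum_eq_zero fun π _ => by
        rw [ind_comm v b]; exact ind_mul_ind_of_ne π b hva.symm]
      simp
    by_cases h2 : b = a
    · subst h2
      simp only [if_pos, if_neg h1]
      rw [Finset.sum_eq_zero fun π _ => by
        rw [ind_comm v b, ind_comm u b]; exact ind_mul_ind_of_ne π b hvu.symm]
      simp
    by_cases h3 : b = v
    · subst h3
      simp [hd, h1, h2]
    · rw [sum_ind_mul_ind hN hN2 hw hua (Ne.symm hvu) (Ne.symm h1) (Ne.symm hva) (Ne.symm h2)
        (Ne.symm h3), if_neg h1, if_neg h2]; ring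
  rw [sum_mul_apply]
  simp only [h, Finset.sum_sub_distrib, ← Finset.mul_sum, hr]
  simp; ring

lemma sum_ind_mul_weight (hN : (Fintype.card V : ℝ) = N + 1) (hN2 : 2 < N)
    (hw : (Fintype.card (FPFInv V) : ℝ) = N * w)
    {Q : V → V → ℝ} (hs : ∀ a b, Q a b = Q b a)
    (hd : ∀ a, Q a a = 0) (hr : ∀ a, ∑ b, Q a b = 0) {u a : V} (hua : u ≠ a) :
    ∑ π, ind u a π * weight Q π = w * ((N - 1) / (N - 2)) * Q u a := by
  have hN0 : N - 2 ≠ 0 := by linarith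
  have h : ∀ v, ∑ π, ind u a π * Q v (π.1 v) = -(w / (N - 2)) * (Q u v + Q a v)
      + (if v = u then w * ((N - 1) / (N - 2)) * Q u a else 0)
      + (if v = a then w * ((N - 1) / (N - 2)) * Q u a else 0) := by
    intro v
    by_cases h1 : v = u
    · subst h1
      rw [sum_ind_mul_apply_left, sum_ind hN (by linarith) hw hua, if_pos rfl, if_neg hua, hd,
        hs a v]
      field_simp; ring
    by_cases h2 : v = a
    · subst h2
      simp only [ind_comm u v]
      rw [sum_ind_mul_apply_left, sum_ind hN (by linarith) hw hua.symm, if_pos trivial, if_neg h1, hd,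
        hs v u]
      field_simp; ring
    rw [sum_ind_mul_apply hN hN2 hw hd hr hua h1 h2, if_neg h1, if_neg h2, hs u v, hs a v]; ring
  rw [sum_mul_weight_eq_sum_apply]
  simp only [h, Finset.sum_add_distrib, ← Finset.mul_sum, hr]
  simp; ring

lemma sum_sq_weight (hN : (Fintype.card V : ℝ) = N + 1) (hN2 : 2 < N)
    (hw : (Fintype.card (FPFInv V) : ℝ) = N * w)
    {Q : V → V → ℝ} (hs : ∀ a b, Q a b = Q b a)
    (hd : ∀ a, Q a a = 0) (hr : ∀ a, ∑ b, Q a b = 0) :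
    ∑ π, weight Q π ^ 2 = w * ((N - 1) / (N - 2)) * ((1 / 2) * ∑ a, ∑ b, Q a b ^ 2) := by
  simp only [pow_two]
  rw [sum_mul_weight, mul_left_comm]
  congr 1
  rw [Finset.mul_sum]
  refine Finset.sum_congr rfl fun u _ => ?_
  rw [Finset.mul_sum]
  refine Finset.sum_congr rfl fun b _ => ?_
  by_cases hub : u = b
  · subst hub; simp [hd]
  · simp only [mul_comm (weight Q _)]
    rw [sum_ind_mul_weight hN hN2 hw hs hd hr hub]; ring

lemma sum_ind_mul_weight_le (hN : (Fintype.card V : ℝ) = N + 1) (hN2 : 2 < N)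
    (hw : (Fintype.card (FPFInv V) : ℝ) = N * w)
    (hw0 : 0 ≤ w) {F : V → V → ℝ} (hs : ∀ a b, F a b = F b a)
    (hF : ∀ a b, 0 ≤ F a b) {u a : V} (hua : u ≠ a) :
    ∑ π, ind u a π * weight F π ≤ w * F u a + w / (N - 2) * ((1 / 2) * ∑ a, ∑ b, F a b) := by
  have hN0 : 0 < N - 2 := by linarith
  have hq : 0 ≤ w / (N - 2) := by positivity
  have h : ∀ v, ∑ π, ind u a π * F v (π.1 v) ≤ w / (N - 2) * ∑ b, F v b
      + (if v = u then w * F u a else 0) + (if v = a then w * F u a else 0) := by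
    intro v
    have h0 : 0 ≤ w / (N - 2) * ∑ b, F v b := mul_nonneg hq (Finset.sum_nonneg fun b _ => hF v b)
    by_cases h1 : v = u
    · subst h1
      rw [sum_ind_mul_apply_left, sum_ind hN (by linarith) hw hua, if_pos rfl, if_neg hua]
      linarith
    by_cases h2 : v = a
    · subst h2
      simp only [ind_comm u v]
      rw [sum_ind_mul_apply_left, sum_ind hN (by linarith) hw hua.symm, if_pos trivial, if_neg h1,
        hs v u]
      linarith
    rw [if_neg h1, if_neg h2, add_zero, add_zero, sum_mul_apply, Finset.mul_sum]
    refine Finset.sum_le_sum fun b _ => ?_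
    rw [mul_comm]
    refine mul_le_mul_of_nonneg_right ?_ (hF v b)
    by_cases h3 : b = u
    · subst h3
      rw [Finset.sum_eq_zero fun π _ => by
        rw [ind_comm v b]; exact ind_mul_ind_of_ne π b (Ne.symm h2)]
      exact hq
    by_cases h4 : b = a
    · subst h4
      rw [Finset.sum_eq_zero fun π _ => by
        rw [ind_comm v b, ind_comm u b]; exact ind_mul_ind_of_ne π b (Ne.symm h1)]
      exact hq
    by_cases h5 : v = b
    · subst h5; simp only [ind_self, mul_zero, Finset.sum_const_zero]; exact hq
    exact (sum_ind_mul_ind hN hN2 hw hua (Ne.symm h1) (Ne.symm h3) (Ne.symm h2) (Ne.symm h4) h5).le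
  rw [sum_mul_weight_eq_sum_apply]
  have h' := Finset.sum_le_sum fun v (_ : v ∈ Finset.univ) => h v
  simp only [Finset.sum_add_distrib, ← Finset.mul_sum, Finset.sum_ite_eq', Finset.mem_univ,
    if_true] at h'
  nlinarith

lemma sum_sq_weight_le (hN : (Fintype.card V : ℝ) = N + 1) (hN2 : 2 < N)
    (hw : (Fintype.card (FPFInv V) : ℝ) = N * w)
    (hw0 : 0 ≤ w) {F : V → V → ℝ} (hs : ∀ a b, F a b = F b a)
    (hd : ∀ a, F a a = 0) (hF : ∀ a b, 0 ≤ F a b) :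
    ∑ π, weight F π ^ 2 ≤ w * ((1 / 2) * ∑ a, ∑ b, F a b ^ 2)
      + w / (N - 2) * ((1 / 2) * ∑ a, ∑ b, F a b) ^ 2 := by
  simp only [pow_two (weight F _)]
  rw [sum_mul_weight]
  set T := (1 / 2) * ∑ a, ∑ b, F a b with hT
  have h : ∑ u, ∑ b, F u b * ∑ π, weight F π * ind u b π ≤
      ∑ u, ∑ b, (w * F u b ^ 2 + w / (N - 2) * T * F u b) := by
    refine Finset.sum_le_sum fun u _ => Finset.sum_le_sum fun b _ => ?_
    by_cases hub : u = b
    · subst hub; simp [hd]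
    · simp only [mul_comm (weight F _)]
      calc _ ≤ F u b * (w * F u b + w / (N - 2) * T) := mul_le_mul_of_nonneg_left
            (sum_ind_mul_weight_le hN hN2 hw hw0 hs hF hub) (hF u b)
        _ = _ := by ring
  simp only [Finset.sum_add_distrib, ← Finset.mul_sum] at h
  have h2 : ∑ a, ∑ b, F a b = 2 * T := by rw [hT]; ring
  rw [h2] at h
  nlinarith

end Moments

end FPFInv

namespace FPFInv

variable {V : Type*} [Fintype V] [DecidableEq V]

/-- The density of `f` on the star of the edge `ab`; `w` is the size of a star. -/
noncomputable def density (w : ℝ) (f : FPFInv V → ℝ) (a b : V) : ℝ :=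
  (∑ π, f π * ind a b π) / w

/-- The density of `f` on the star of `ab`, centered by its mean `t`. -/
noncomputable def centered (w t : ℝ) (f : FPFInv V → ℝ) (a b : V) : ℝ :=
  if a = b then 0 else density w f a b - t

section Density

variable {N w c : ℝ} {f : FPFInv V → ℝ}

lemma density_comm (a b : V) : density w f a b = density w f b a := by
  simp only [density, ind_comm a b]

lemma density_self (a : V) : density w f a a = 0 := by
  simp [density, ind_self]

lemma density_nonneg (hw0 : 0 < w) (hf : ∀ π, f π = 0 ∨ f π = 1) (a b : V) :
    0 ≤ density w f a b := by
  refine div_nonneg (Finset.sum_nonneg fun π _ => mul_nonneg ?_ (ind_nonneg a b π)) hw0.le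
  rcases hf π with h | h <;> simp [h]

lemma density_le_one (hN : (Fintype.card V : ℝ) = N + 1) (hN0 : N ≠ 0)
    (hw : (Fintype.card (FPFInv V) : ℝ) = N * w) (hw0 : 0 < w) (hf : ∀ π, f π = 0 ∨ f π = 1)
    (a b : V) : density w f a b ≤ 1 := by
  by_cases hab : a = b
  · subst hab; simp [density_self]
  rw [density, div_le_one hw0, ← sum_ind hN hN0 hw hab]
  refine Finset.sum_le_sum fun π _ => ?_
  have := ind_nonneg a b π
  rcases hf π with h | h <;> simp [h, this]

lemma density_le (hw0 : 0 < w) (hf : ∀ π, f π = 0 ∨ f π = 1) (hc : ∑ π, f π = c * w) (a b : V) :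
    density w f a b ≤ c := by
  rw [density, div_le_iff₀ hw0, ← hc]
  refine Finset.sum_le_sum fun π _ => ?_
  unfold ind
  rcases hf π with h | h <;> split_ifs <;> simp [h]

lemma sum_density (hw0 : 0 < w) (hc : ∑ π, f π = c * w) (a : V) :
    ∑ b, density w f a b = c := by
  simp only [density]
  rw [← Finset.sum_div, Finset.sum_comm, div_eq_iff hw0.ne', ← hc]
  refine Finset.sum_congr rfl fun π _ => ?_
  rw [← Finset.mul_sum]
  simp [ind]

lemma centered_comm (t : ℝ) (a b : V) : centered w t f a b = centered w t f b a := by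
  simp only [centered, density_comm a b, eq_comm (a := a)]

lemma centered_self (t : ℝ) (a : V) : centered w t f a a = 0 := by simp [centered]

lemma centered_of_ne (t : ℝ) {a b : V} (h : a ≠ b) :
    centered w t f a b = density w f a b - t := by simp [centered, h]

lemma sum_centered (hN : (Fintype.card V : ℝ) = N + 1) (hN0 : N ≠ 0) (hw0 : 0 < w)
    (hc : ∑ π, f π = c * w) (a : V) : ∑ b, centered w (c / N) f a b = 0 := by
  have h : ∀ b, centered w (c / N) f a b = density w f a b - c / N + if b = a then c / N else 0 := by
    intro b
    by_cases h : a = b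
    · subst h; simp [centered, density_self]
    · simp [centered, h, Ne.symm h]
  simp only [h, Finset.sum_add_distrib, Finset.sum_sub_distrib, sum_density hw0 hc]
  simp [hN]
  field_simp; ring

lemma sum_mul_weight_eq_density (hw0 : 0 < w) (F : V → V → ℝ) :
    ∑ π, f π * weight F π = w * ((1 / 2) * ∑ a, ∑ b, F a b * density w f a b) := by
  rw [sum_mul_weight, mul_left_comm]
  congr 1
  rw [Finset.mul_sum]
  refine Finset.sum_congr rfl fun u _ => ?_
  rw [Finset.mul_sum]
  refine Finset.sum_congr rfl fun b _ => ?_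
  rw [density]
  field_simp

lemma sum_mul_weight_centered (hN : (Fintype.card V : ℝ) = N + 1) (hN0 : N ≠ 0) (hw0 : 0 < w)
    (hc : ∑ π, f π = c * w) :
    ∑ π, f π * weight (centered w (c / N) f) π =
      w * ((1 / 2) * ∑ a, ∑ b, centered w (c / N) f a b ^ 2) := by
  rw [sum_mul_weight_eq_density hw0]
  congr 2
  refine Finset.sum_congr rfl fun a _ => ?_
  have h : ∀ b, centered w (c / N) f a b * density w f a b =
      centered w (c / N) f a b ^ 2 + c / N * centered w (c / N) f a b := by
    intro b
    by_cases h : a = b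
    · subst h; simp [centered_self]
    · rw [centered_of_ne _ h]; ring
  simp only [h, Finset.sum_add_distrib, ← Finset.mul_sum, sum_centered hN hN0 hw0 hc, mul_zero,
    add_zero]

end Density

lemma posPart_cube_ge (y : ℝ) : 3 * y - 2 ≤ max y 0 ^ 3 := by
  rcases le_total y 0 with h | h
  · simp [h]; linarith
  · simp only [max_eq_left h]; nlinarith [sq_nonneg (y - 1)]

/-- The purely numerical part of `weighted_defect_le`. -/
lemma defect_arith {N w c s S R A B G : ℝ} (hN : 100 ≤ N) (hw0 : 0 < w) (hc0 : 0 ≤ c)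
    (hs0 : 0 ≤ s) (hs1 : s ≤ 1 / 100) (hct : c ≤ N / 100)
    (h1 : (N - 2) * A ≤ (N - 1) * B + 2 * S * G) (h2 : w * (3 * S - 2 * c) ≤ A)
    (h3 : (N - 2) / (N - 1) * B ≤ w * R + 2 * s * c * w)
    (h4 : (N - 2) / (N - 1) * G ≤ c * w + s * N * w)
    (hS0 : c - c * (c / N) - s ^ 2 * c ≤ S) (hS1 : S ≤ c * (1 + 2 / N)) (hS : 0 ≤ S) :
    S - R ≤ 13 * c * (1 / N + c / N + s) := by
  have hNp : 0 < N := by linarith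
  set α := (N - 2) / (N - 1) with hα
  have hα0 : 1 - 2 / N ≤ α := by
    rw [hα, le_div_iff₀ (by linarith)]
    have : 2 / N * N = 2 := by field_simp
    have h0 : 2 / N ≤ 1 := by rw [div_le_one hNp]; linarith
    nlinarith
  have hα1 : α ≤ 1 := by rw [hα, div_le_one (by linarith)]; linarith
  have hN1 : 2 / N ≤ 1 / 50 := by rw [div_le_div_iff₀ hNp (by norm_num)]; linarith
  have hN3 : 0 < 2 / N := by positivity
  set ν := 2 / N with hν
  have hαp : 0 < α := by linarith
  have ht0 : 0 ≤ c / N := by positivity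
  have ht1 : c / N ≤ 1 / 100 := by rw [div_le_div_iff₀ hNp (by norm_num)]; linarith
  set t := c / N with ht
  have hct' : c = t * N := by rw [ht]; field_simp
  have k1 : α * A ≤ B + 2 * S / (N - 1) * G := by
    have : α * A = ((N - 2) * A) / (N - 1) := by rw [hα]; ring
    rw [this, div_le_iff₀ (by linarith)]
    have e : (B + 2 * S / (N - 1) * G) * (N - 1) = (N - 1) * B + 2 * S * G := by
      have : N - 1 ≠ 0 := by linarith
      field_simp
    rw [e]; exact h1
  have k2 : α ^ 2 * A ≤ w * R + 2 * s * c * w + 2 * S / (N - 1) * (c * w + s * N * w) := by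
    have h5 : 0 ≤ 2 * S / (N - 1) := div_nonneg (by linarith) (by linarith)
    have h6 := mul_le_mul_of_nonneg_left k1 hαp.le
    have h7 := mul_le_mul_of_nonneg_left h4 h5
    linear_combination h6 + h7 + h3
  have k3 : 2 * S / (N - 1) * (c * w + s * N * w) ≤ w * (8 * c * (t + s)) := by
    have hS2 : S ≤ 2 * c := by
      linear_combination hS1 + c * hN1 + 49 / 50 * hc0
    have : 2 * S / (N - 1) * (c * w + s * N * w) = w * (2 * S * (t + s)) * (N / (N - 1)) := by
      rw [hct']; ring
    have hq : N / (N - 1) ≤ 2 := by rw [div_le_iff₀ (by linarith)]; linarith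
    have hp : 0 ≤ w * (2 * S * (t + s)) := by positivity
    rw [this]
    calc _ ≤ w * (2 * S * (t + s)) * 2 := mul_le_mul_of_nonneg_left hq hp
      _ = w * (4 * S * (t + s)) := by ring
      _ ≤ w * (8 * c * (t + s)) := by
        refine mul_le_mul_of_nonneg_left ?_ hw0.le
        have : 0 ≤ t + s := by linarith
        linear_combination 4 * mul_le_mul_of_nonneg_right hS2 this
  have k4 : α ^ 2 * (3 * S - 2 * c) ≤ R + 2 * s * c + 8 * c * (t + s) := by
    have h5 := mul_le_mul_of_nonneg_left h2 (sq_nonneg α)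
    have h6 : w * (α ^ 2 * (3 * S - 2 * c)) ≤ w * (R + 2 * s * c + 8 * c * (t + s)) := by
      linear_combination h5 + k2 + k3
    exact le_of_mul_le_mul_left h6 hw0
  have hs2 : s ^ 2 ≤ s := by
    rw [pow_two]; exact mul_le_of_le_one_left hs0 (by linarith)
  have k5 : c * (1 - 3 * t - 3 * s) ≤ 3 * S - 2 * c := by
    linear_combination 3 * hS0 + 3 * mul_le_mul_of_nonneg_left hs2 hc0
  have hα2 : 1 - 2 * ν ≤ α ^ 2 := by
    linear_combination 2 * hα0 + sq_nonneg (α - 1)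
  have k6 : c * (1 - 3 * t - 3 * s - 2 * ν) ≤ α ^ 2 * (3 * S - 2 * c) := by
    have h5 : 0 ≤ c * (1 - 3 * t - 3 * s) := mul_nonneg hc0 (by linarith)
    have h6 : (1 - 2 * ν) * (c * (1 - 3 * t - 3 * s)) ≤ α ^ 2 * (3 * S - 2 * c) :=
      mul_le_mul hα2 k5 h5 (sq_nonneg α)
    have h7 : 0 ≤ c * ν * (t + s) := by positivity
    linear_combination h6 + 6 * h7
  have e1 : 1 / N = ν / 2 := by rw [hν]; ring
  rw [e1]
  have m1 : 0 ≤ c * ν := by positivity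
  have m2 : 0 ≤ c * t := by positivity
  linear_combination k6 + k4 + hS1 + 2 * m2 + 7 / 2 * m1

set_option maxHeartbeats 1000000 in
/-- If the projection of the 0/1-valued function `f` onto the span of the stars is close to `f`,
then the densities of `f` on the stars are, in a weighted sense, close to zero or one. -/
theorem weighted_defect_le {N w c ε : ℝ} {f : FPFInv V → ℝ} (hN : (Fintype.card V : ℝ) = N + 1)
    (hN2 : 100 ≤ N) (hw : (Fintype.card (FPFInv V) : ℝ) = N * w) (hw0 : 0 < w)
    (hf : ∀ π, f π = 0 ∨ f π = 1) (hc : ∑ π, f π = c * w) (hc0 : 0 ≤ c) (hct : c ≤ N / 100)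
    (hε0 : 0 ≤ ε) (hε1 : Real.sqrt ε ≤ 1 / 100)
    (hD : ∑ π, (f π - (c / N + (N - 2) / (N - 1) * weight (centered w (c / N) f) π)) ^ 2
      ≤ ε * (c * w)) :
    (1 / 2) * ∑ a, ∑ b, centered w (c / N) f a b ^ 2 * (1 - density w f a b)
      ≤ 13 * c * (1 / N + c / N + Real.sqrt ε) ∧
    c - c * (c / N) - ε * c ≤ (1 / 2) * ∑ a, ∑ b, centered w (c / N) f a b ^ 2 ∧
    (1 / 2) * ∑ a, ∑ b, centered w (c / N) f a b ^ 2 ≤ c * (1 + 2 / N) := by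
  have hNp : 0 < N := by linarith
  set t := c / N with ht
  set Q := centered w t f with hQ
  set s := Real.sqrt ε with hs
  have hs0 : 0 ≤ s := Real.sqrt_nonneg _
  have hsε : s ^ 2 = ε := Real.sq_sqrt hε0
  set S := (1 / 2) * ∑ a, ∑ b, Q a b ^ 2 with hS
  set R := (1 / 2) * ∑ a, ∑ b, Q a b ^ 2 * density w f a b with hR
  set α := (N - 2) / (N - 1) with hα
  have hα1 : α ≤ 1 := by rw [hα, div_le_one (by linarith)]; linarith
  have hαp : 0 < α := div_pos (by linarith) (by linarith)
  have qs : ∀ a b, Q a b = Q b a := centered_comm t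
  have qd : ∀ a, Q a a = 0 := centered_self t
  have qr : ∀ a, ∑ b, Q a b = 0 := sum_centered hN hNp.ne' hw0 hc
  have hS0 : 0 ≤ S := by
    refine mul_nonneg (by norm_num) (Finset.sum_nonneg fun a _ => Finset.sum_nonneg fun b _ => ?_)
    positivity
  have ht0 : 0 ≤ t := by positivity
  have ht1 : t ≤ 1 / 100 := by rw [ht, div_le_div_iff₀ hNp (by norm_num)]; linarith
  have hct' : c = t * N := by rw [ht]; field_simp
  have hQ1 : ∀ a b, Q a b ^ 2 ≤ 1 := by
    intro a b
    by_cases hab : a = b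
    · subst hab; rw [qd]; norm_num
    · rw [hQ, centered_of_ne t hab]
      have h1 := density_nonneg hw0 hf a b
      have h2 := density_le_one hN hNp.ne' hw hw0 hf a b
      nlinarith
  set Y := weight Q with hY
  set Z := weight (fun a b => Q a b ^ 2) with hZ
  have hZ0 : ∀ π, 0 ≤ Z π := weight_nonneg fun a b => sq_nonneg _
  set h := fun π => t + α * Y π with hh
  have hfY : ∑ π, f π * Y π = w * S := sum_mul_weight_centered hN hNp.ne' hw0 hc
  have hYY : ∑ π, Y π ^ 2 = w * ((N - 1) / (N - 2)) * S :=
    sum_sq_weight hN (by linarith) hw qs qd qr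
  have hY1 : ∑ π, Y π = 0 := by
    rw [hY, sum_weight hN hNp.ne' hw qd]; simp [qr]
  have hff : ∑ π, f π ^ 2 = c * w := by
    rw [← hc]; exact Finset.sum_congr rfl fun π _ => by rcases hf π with h | h <;> simp [h]
  have hDeq : ∑ π, (f π - h π) ^ 2 = w * (c - c * t - α * S) := by
    have e : ∀ π, (f π - h π) ^ 2 = f π ^ 2 - 2 * t * f π - 2 * α * (f π * Y π) + t ^ 2
        + 2 * t * α * Y π + α ^ 2 * Y π ^ 2 := fun π => by simp only [hh]; ring
    simp only [e, Finset.sum_add_distrib, Finset.sum_sub_distrib, ← Finset.mul_sum, hff, hc, hfY,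
      hY1, hYY, Finset.sum_const, Finset.card_univ, nsmul_eq_mul, hw]
    have e2 : α * ((N - 1) / (N - 2)) = 1 := by
      rw [hα]
      have : N - 1 ≠ 0 := by linarith
      have : N - 2 ≠ 0 := by linarith
      field_simp
    have e3 : α ^ 2 * (w * ((N - 1) / (N - 2)) * S) = w * α * S * (α * ((N - 1) / (N - 2))) := by
      ring
    rw [e3, e2, hct']; ring
  have hD' : ∑ π, (f π - h π) ^ 2 ≤ s ^ 2 * c * w := by rw [hsε]; linarith
  have hDnn : 0 ≤ ∑ π, (f π - h π) ^ 2 := Finset.sum_nonneg fun _ _ => sq_nonneg _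
  have hαS : c - c * t - ε * c ≤ α * S ∧ α * S ≤ c := by
    rw [hDeq] at hD' hDnn
    constructor
    · have : w * (c - c * t - α * S) ≤ w * (ε * c) := by rw [← hsε]; linarith
      have := le_of_mul_le_mul_left this hw0
      linarith
    · have := nonneg_of_mul_nonneg_right hDnn hw0
      nlinarith
  have hSlow : c - c * t - ε * c ≤ S := hαS.1.trans (by nlinarith)
  have hSup : S ≤ c * (1 + 2 / N) := by
    have e : S = (α * S) * ((N - 1) / (N - 2)) := by
      rw [hα]
      have : N - 1 ≠ 0 := by linarith
      have : N - 2 ≠ 0 := by linarith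
      field_simp
    have e2 : (N - 1) / (N - 2) ≤ 1 + 2 / N := by
      rw [div_le_iff₀ (by linarith)]
      have : 2 / N * N = 2 := by field_simp
      have h0 : 2 / N ≤ 1 / 4 := by rw [div_le_div_iff₀ hNp (by norm_num)]; linarith
      nlinarith
    rw [e]
    exact mul_le_mul hαS.2 e2 (div_nonneg (by linarith) (by linarith)) hc0
  refine ⟨?_, hSlow, hSup⟩
  have hS2 : S ≤ 2 * c := by
    have h0 : 2 / N ≤ 1 := by rw [div_le_one hNp]; linarith
    nlinarith
  have hZ2 : ∑ π, Z π ^ 2 ≤ 4 * c * w := by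
    have h1 := sum_sq_weight_le hN (by linarith) hw hw0.le (F := fun a b => Q a b ^ 2)
      (fun a b => by simp only [qs a b]) (fun a => by simp [qd]) (fun a b => sq_nonneg _)
    have h2 : (1 / 2) * ∑ a, ∑ b, (Q a b ^ 2) ^ 2 ≤ S := by
      refine mul_le_mul_of_nonneg_left (Finset.sum_le_sum fun a _ => Finset.sum_le_sum fun b _ => ?_)
        (by norm_num)
      have := hQ1 a b
      have := sq_nonneg (Q a b)
      nlinarith
    have h3 : S ^ 2 / (N - 2) ≤ 2 * c := by
      rw [div_le_iff₀ (by linarith)]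
      nlinarith
    have h4 : w / (N - 2) * S ^ 2 = w * (S ^ 2 / (N - 2)) := by ring
    have h5 := mul_le_mul_of_nonneg_left h2 hw0.le
    have h6 := mul_le_mul_of_nonneg_left h3 hw0.le
    have h7 := mul_le_mul_of_nonneg_left hS2 hw0.le
    calc _ ≤ _ := h1
      _ ≤ _ := by rw [← hS, h4]; linarith
  have hpt : ∀ π, α * max (Y π) 0 ≤ f π + |f π - h π| := by
    intro π
    have h1 : 0 ≤ f π := by rcases hf π with h | h <;> simp [h]
    rcases le_total (Y π) 0 with hy | hy
    · rw [max_eq_right hy]; have := abs_nonneg (f π - h π); linarith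
    · rw [max_eq_left hy]
      have h2 := neg_abs_le (f π - h π)
      have h3 : h π = t + α * Y π := rfl
      linarith
  have hCSZ : ∑ π, |f π - h π| * Z π ≤ 2 * s * c * w := by
    have h1 := Finset.sum_mul_sq_le_sq_mul_sq Finset.univ (fun π => |f π - h π|) Z
    simp only [sq_abs] at h1
    refine abs_le_of_sq_le_sq' (h1.trans ?_) (by positivity) |>.2
    calc _ ≤ (s ^ 2 * c * w) * (4 * c * w) := mul_le_mul hD' hZ2
          (Finset.sum_nonneg fun _ _ => sq_nonneg _) (by positivity)
      _ = _ := by ring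
  have hCS1 : ∑ π, |f π - h π| ≤ s * N * w := by
    have h1 := Finset.sum_mul_sq_le_sq_mul_sq Finset.univ (fun π => |f π - h π|) (fun _ => 1)
    simp only [sq_abs, mul_one, one_pow, Finset.sum_const, Finset.card_univ, nsmul_eq_mul, hw] at h1
    refine abs_le_of_sq_le_sq' (h1.trans ?_) (by positivity) |>.2
    calc _ ≤ (s ^ 2 * c * w) * (N * w) := mul_le_mul_of_nonneg_right hD' (by positivity)
      _ ≤ (s ^ 2 * N * w) * (N * w) := by
          have : c ≤ N := by linarith
          gcongr
      _ = _ := by ring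
  have hfZ : ∑ π, f π * Z π = w * R := sum_mul_weight_eq_density hw0 _
  have main := defect_arith (R := R) (A := ∑ π, max (Y π) 0 ^ 3) (B := ∑ π, max (Y π) 0 * Z π)
    (G := ∑ π, max (Y π) 0) hN2 hw0 hc0 hs0 hε1 hct
    (by
      have := sum_posPart_cube_le hN qs qd qr
      have e : ∑ a, ∑ b, Q a b ^ 2 = 2 * S := by rw [hS]; ring
      rw [e] at this; exact this)
    (by
      calc w * (3 * S - 2 * c) = ∑ π, (3 * (f π * Y π) - 2 * f π) := by
            simp only [Finset.sum_sub_distrib, ← Finset.mul_sum, hfY, hc]; ring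
        _ ≤ _ := Finset.sum_le_sum fun π _ => by
            have h1 := posPart_cube_ge (Y π)
            have h2 : 0 ≤ max (Y π) 0 ^ 3 := by positivity
            rcases hf π with h | h <;> simp only [h] <;> linarith)
    (by
      rw [Finset.mul_sum]
      calc _ ≤ ∑ π, (f π * Z π + |f π - h π| * Z π) := Finset.sum_le_sum fun π _ => by
            have := mul_le_mul_of_nonneg_right (hpt π) (hZ0 π)
            linarith
        _ ≤ _ := by rw [Finset.sum_add_distrib, hfZ]; linarith)
    (by
      rw [Finset.mul_sum]
      calc _ ≤ ∑ π, (f π + |f π - h π|) := Finset.sum_le_sum fun π _ => hpt π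
        _ ≤ _ := by rw [Finset.sum_add_distrib, hc]; linarith)
    (by rw [hsε]; linarith) hSup hS0
  calc _ = S - R := by
        rw [hS, hR, ← mul_sub]
        simp only [← Finset.sum_sub_distrib]
        congr 1
        exact Finset.sum_congr rfl fun a _ => Finset.sum_congr rfl fun b _ => by ring
    _ ≤ _ := main

end FPFInv

/-- Perfect matchings of the complete graph correspond to fixed-point-free involutions. -/
noncomputable def pmEquiv (n : ℕ) : PerfMatching n ≃ FPFInv (Fin (2 * n)) where
  toFun M :=
    have hM := SimpleGraph.Subgraph.isPerfectMatching_iff.1 M.2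
    have hinv : Function.Involutive fun v => (hM v).choose := fun v =>
      ((hM _).choose_spec.2 v (hM v).choose_spec.1.symm).symm
    ⟨hinv.toPerm, hinv, fun v => (hM v).choose_spec.1.ne.symm⟩
  invFun π :=
    ⟨{ verts := Set.univ
       Adj := fun a b => π.1 a = b
       adj_sub := fun {a b} h => by
         rw [SimpleGraph.top_adj]; rintro rfl; exact π.2.2 a h
       edge_vert := fun _ => Set.mem_univ _
       symm := ⟨fun a b h => π.apply_eq_iff.1 h⟩ },
      SimpleGraph.Subgraph.isPerfectMatching_iff.2 fun v =>
        ⟨π.1 v, rfl, fun _ h => Eq.symm (a := π.1 v) h⟩⟩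
  left_inv M := by
    have hM := SimpleGraph.Subgraph.isPerfectMatching_iff.1 M.2
    refine Subtype.ext (SimpleGraph.Subgraph.ext ?_ ?_)
    · exact (SimpleGraph.Subgraph.isSpanning_iff.1 M.2.2).symm
    · ext a b
      exact ⟨fun h => h ▸ (hM a).choose_spec.1, fun h => ((hM a).choose_spec.2 b h).symm⟩
  right_inv π := by
    refine Subtype.ext (Equiv.ext fun v => ?_)
    have hM : ∀ v, ∃! w, π.1 v = w := fun v => ⟨π.1 v, rfl, fun _ h => h.symm⟩
    exact (hM v).choose_spec.1.symm

lemma pmEquiv_apply_eq_iff {n : ℕ} (M : PerfMatching n) (a b : Fin (2 * n)) :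
    (pmEquiv n M).1 a = b ↔ s(a, b) ∈ M.1.edgeSet := by
  have hM := SimpleGraph.Subgraph.isPerfectMatching_iff.1 M.2
  rw [SimpleGraph.Subgraph.mem_edgeSet]
  exact ⟨fun h => h ▸ (hM a).choose_spec.1, fun h => ((hM a).choose_spec.2 b h).symm⟩

lemma doubleFactorial_two_mul_sub_one {n : ℕ} (hn : 1 ≤ n) :
    (2 * n - 1)‼ = (2 * n - 1) * (2 * n - 3)‼ := by
  obtain ⟨m, rfl⟩ : ∃ m, n = m + 1 := ⟨n - 1, by omega⟩
  rw [show 2 * (m + 1) - 1 = 2 * m + 1 by omega, Nat.doubleFactorial_add_one]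
  rfl

/-- The edge of the complete graph with the given distinct end points. -/
def KEdge.mk {n : ℕ} (a b : Fin (2 * n)) (h : a ≠ b) : KEdge n :=
  ⟨s(a, b), by simpa using h⟩

lemma KEdge.exists_mk {n : ℕ} (e : KEdge n) : ∃ a b h, e = KEdge.mk a b h := by
  obtain ⟨e, he⟩ := e
  induction e with
  | _ a b => exact ⟨a, b, by simpa using he, rfl⟩

lemma KEdge.mk_eq_mk_iff {n : ℕ} {a b x y : Fin (2 * n)} {h : a ≠ b} {h' : x ≠ y} :
    KEdge.mk a b h = KEdge.mk x y h' ↔ a = x ∧ b = y ∨ a = y ∧ b = x := by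
  simp [KEdge.mk]

lemma indicatorVec_apply {n : ℕ} (S : Set (PerfMatching n)) (M : PerfMatching n) :
    indicatorVec S M = S.indicator 1 M := rfl

lemma indicatorVec_of_mem {n : ℕ} {S : Set (PerfMatching n)} {M : PerfMatching n} (h : M ∈ S) :
    indicatorVec S M = 1 := by
  simp [indicatorVec_apply, h]

lemma indicatorVec_of_notMem {n : ℕ} {S : Set (PerfMatching n)} {M : PerfMatching n}
    (h : M ∉ S) : indicatorVec S M = 0 := by
  simp [indicatorVec_apply, h]

lemma indicatorVec_eq_zero_or_one {n : ℕ} (S : Set (PerfMatching n)) (M : PerfMatching n) :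
    indicatorVec S M = 0 ∨ indicatorVec S M = 1 := by
  by_cases h : M ∈ S <;> simp [indicatorVec_apply, h]

lemma sum_indicatorVec {n : ℕ} (S : Set (PerfMatching n)) :
    ∑ M, indicatorVec S M = (S.ncard : ℝ) := by
  classical
  simp only [indicatorVec_apply, Set.indicator_apply, Pi.one_apply]
  rw [Finset.sum_boole, Set.ncard_eq_toFinset_card', Set.toFinset_card, Fintype.card_subtype]

lemma indicatorVec_pmStar_mk {n : ℕ} (a b : Fin (2 * n)) (h : a ≠ b) (M : PerfMatching n) :
    indicatorVec (pmStar n (KEdge.mk a b h)) M = FPFInv.ind a b (pmEquiv n M) := by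
  classical
  rw [indicatorVec_apply, Set.indicator_apply, FPFInv.ind]
  exact if_congr (pmEquiv_apply_eq_iff M a b).symm rfl rfl

/-- The 0/1-valued function on involutions corresponding to a family of perfect matchings. -/
noncomputable def involutionIndicator {n : ℕ} (A : Set (PerfMatching n))
    (π : FPFInv (Fin (2 * n))) : ℝ :=
  indicatorVec A ((pmEquiv n).symm π)

lemma involutionIndicator_eq_zero_or_one {n : ℕ} (A : Set (PerfMatching n))
    (π : FPFInv (Fin (2 * n))) : involutionIndicator A π = 0 ∨ involutionIndicator A π = 1 :=
  indicatorVec_eq_zero_or_one A _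

lemma sum_involutionIndicator {n : ℕ} (A : Set (PerfMatching n)) :
    ∑ π, involutionIndicator A π = (A.ncard : ℝ) := by
  rw [← sum_indicatorVec]
  exact Equiv.sum_comp (pmEquiv n).symm fun M => indicatorVec A M

section Setup

variable {n : ℕ}

lemma card_fin_two_mul (n : ℕ) : (Fintype.card (Fin (2 * n)) : ℝ) = (2 * (n : ℝ) - 1) + 1 := by
  simp

lemma card_fpfInv_fin (hn : 1 ≤ n) : (Fintype.card (FPFInv (Fin (2 * n))) : ℝ) =
    (2 * (n : ℝ) - 1) * ((2 * n - 3)‼ : ℕ) := by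
  rw [FPFInv.card_eq_doubleFactorial n (by simp), doubleFactorial_two_mul_sub_one hn, Nat.cast_mul,
    Nat.cast_sub (by omega)]
  push_cast; ring

lemma ncard_pmStar (hn : 1 ≤ n) (e : KEdge n) :
    ((pmStar n e).ncard : ℝ) = ((2 * n - 3)‼ : ℕ) := by
  obtain ⟨a, b, h, rfl⟩ := e.exists_mk
  rw [← sum_indicatorVec]
  simp only [indicatorVec_pmStar_mk]
  rw [Equiv.sum_comp (pmEquiv n) (FPFInv.ind a b)]
  have : (1 : ℝ) ≤ n := by exact_mod_cast hn
  exact FPFInv.sum_ind (card_fin_two_mul n) (by linarith) (card_fpfInv_fin hn) h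

lemma sum_pmStar_mul_pmStar_le (hn : 2 ≤ n) {e e' : KEdge n} (hee : e ≠ e') :
    ∑ M, indicatorVec (pmStar n e) M * indicatorVec (pmStar n e') M ≤
      ((2 * n - 3)‼ : ℕ) / ((2 * (n : ℝ) - 1) - 2) := by
  obtain ⟨a, b, h, rfl⟩ := e.exists_mk
  obtain ⟨x, y, h', rfl⟩ := e'.exists_mk
  have hn' : (2 : ℝ) ≤ n := by exact_mod_cast hn
  have h0 : (0 : ℝ) ≤ ((2 * n - 3)‼ : ℕ) / ((2 * (n : ℝ) - 1) - 2) :=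
    div_nonneg (Nat.cast_nonneg _) (by linarith)
  simp only [indicatorVec_pmStar_mk]
  rw [Equiv.sum_comp (pmEquiv n) fun π => FPFInv.ind a b π * FPFInv.ind x y π]
  rw [Ne, KEdge.mk_eq_mk_iff, not_or, not_and, not_and] at hee
  by_cases h1 : a = x
  · subst h1
    rw [Finset.sum_eq_zero fun π _ => FPFInv.ind_mul_ind_of_ne π a (hee.1 rfl)]; exact h0
  by_cases h2 : a = y
  · subst h2
    rw [Finset.sum_eq_zero fun π _ => by
      rw [FPFInv.ind_comm x a]; exact FPFInv.ind_mul_ind_of_ne π a (hee.2 rfl)]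
    exact h0
  by_cases h3 : b = x
  · subst h3
    rw [Finset.sum_eq_zero fun π _ => by
      rw [FPFInv.ind_comm a b]; exact FPFInv.ind_mul_ind_of_ne π b h2]
    exact h0
  by_cases h4 : b = y
  · subst h4
    rw [Finset.sum_eq_zero fun π _ => by
      rw [FPFInv.ind_comm a b, FPFInv.ind_comm x b]; exact FPFInv.ind_mul_ind_of_ne π b h1]
    exact h0
  have := FPFInv.sum_ind_mul_ind (card_fin_two_mul n) (by linarith) (card_fpfInv_fin (by omega))
    h h1 h2 h3 h4 h'
  exact this.le

lemma sum_sum_eq_sum_kEdge (G : Fin (2 * n) → Fin (2 * n) → ℝ) (ψ : KEdge n → ℝ)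
    (hd : ∀ a, G a a = 0) (hψ : ∀ a b h, ψ (KEdge.mk a b h) = G a b) :
    (1 / 2) * ∑ a, ∑ b, G a b = ∑ e, ψ e := by
  classical
  have h1 : ∀ a b, G a b = ∑ e : KEdge n, if e.1 = s(a, b) then ψ e else 0 := by
    intro a b
    by_cases h : a = b
    · subst h
      rw [hd, Finset.sum_eq_zero]
      intro e _
      obtain ⟨x, y, h, rfl⟩ := e.exists_mk
      refine if_neg fun h' => h ?_
      simp only [KEdge.mk, Sym2.eq_iff] at h'
      rcases h' with h' | h' <;> rw [h'.1, h'.2]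
    · rw [Finset.sum_eq_single (KEdge.mk a b h)]
      · simp [KEdge.mk, ← hψ a b h]
      · intro e _ he
        exact if_neg fun h' => he (Subtype.ext h')
      · simp
  have h2 : ∀ e : KEdge n, ∑ a, ∑ b, (if e.1 = s(a, b) then ψ e else 0) = 2 * ψ e := by
    intro e
    obtain ⟨x, y, h, rfl⟩ := e.exists_mk
    have : ∀ a b, (if (KEdge.mk x y h).1 = s(a, b) then ψ (KEdge.mk x y h) else 0) =
      (if b = y then if a = x then ψ (KEdge.mk x y h) else 0 else 0) +
        (if b = x then if a = y then ψ (KEdge.mk x y h) else 0 else 0) := by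
      intro a b
      simp only [KEdge.mk, Sym2.eq_iff]
      by_cases hb : b = y
      · subst hb
        by_cases ha : a = x
        · subst ha; simp [h, h.symm]
        · simp [ha, Ne.symm ha, h, h.symm]
      · by_cases hb' : b = x
        · subst hb'
          simp [h, Ne.symm h, eq_comm]
        · simp [hb, hb', Ne.symm hb, Ne.symm hb']
    simp only [this, Finset.sum_add_distrib]
    simp; ring
  calc _ = (1 / 2) * ∑ a, ∑ b, ∑ e : KEdge n, (if e.1 = s(a, b) then ψ e else 0) := by
        simp only [← h1]
    _ = (1 / 2) * ∑ e : KEdge n, ∑ a, ∑ b, (if e.1 = s(a, b) then ψ e else 0) := by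
        congr 1
        rw [Finset.sum_comm]
        rw [Finset.sum_comm]
        refine (Finset.sum_congr rfl fun a _ => Finset.sum_comm).trans ?_
        rw [Finset.sum_comm]
    _ = _ := by simp only [h2]; rw [← Finset.mul_sum]; ring

end Setup

open FPFInv in
/-- The orthogonal projection onto the span of the stars in terms of edge densities. -/
theorem starProjection_indicatorVec {n : ℕ} (hn : 2 ≤ n) (A : Set (PerfMatching n)) {N w c : ℝ}
    (hNn : N = 2 * (n : ℝ) - 1) (hwn : w = ((2 * n - 3)‼ : ℕ)) (hc : (A.ncard : ℝ) = c * w)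
    (M : PerfMatching n) :
    (starSpan n).starProjection (indicatorVec A) M =
      c / N + (N - 2) / (N - 1) *
        weight (centered w (c / N) (involutionIndicator A)) (pmEquiv n M) := by
  have hn' : (2 : ℝ) ≤ n := by exact_mod_cast hn
  have hN : (Fintype.card (Fin (2 * n)) : ℝ) = N + 1 := by rw [hNn]; exact card_fin_two_mul n
  have hw : (Fintype.card (FPFInv (Fin (2 * n))) : ℝ) = N * w := by
    rw [hNn, hwn]; exact card_fpfInv_fin (by omega)
  have hw0 : 0 < w := by rw [hwn]; exact_mod_cast Nat.doubleFactorial_pos _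
  have hN2 : 2 < N := by linarith
  have hc' : ∑ π, involutionIndicator A π = c * w := by rw [sum_involutionIndicator, hc]
  set Q := centered w (c / N) (involutionIndicator A) with hQ
  set α := (N - 2) / (N - 1) with hα
  set h : EuclideanSpace ℝ (PerfMatching n) :=
    WithLp.toLp 2 fun M => c / N + α * weight Q (pmEquiv n M) with hh
  have hmem : h ∈ starSpan n := by
    have h1 : h = ∑ u, ∑ b, if hub : u ≠ b then
        (c / N / (N + 1) + α * (1 / 2) * Q u b) • indicatorVec (pmStar n (KEdge.mk u b hub))
        else 0 := by
      ext M
      have h2 : ∀ u b, (if hub : u ≠ b then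
          (c / N / (N + 1) + α * (1 / 2) * Q u b) • indicatorVec (pmStar n (KEdge.mk u b hub))
          else 0 : EuclideanSpace ℝ (PerfMatching n)) M =
          ind u b (pmEquiv n M) * (c / N / (N + 1) + α * (1 / 2) * Q u b) := by
        intro u b
        by_cases hub : u = b
        · subst hub; simp [ind_self]
        · simp [hub, indicatorVec_pmStar_mk, mul_comm]
      have h3 : ∀ u, ∑ b, ind u b (pmEquiv n M) * (c / N / (N + 1) + α * (1 / 2) * Q u b) =
          c / N / (N + 1) + α * (1 / 2) * Q u ((pmEquiv n M).1 u) := fun u =>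
        sum_ind_mul (pmEquiv n M) u fun b => c / N / (N + 1) + α * (1 / 2) * Q u b
      simp only [WithLp.ofLp_sum, Finset.sum_apply, h2, h3]
      rw [Finset.sum_add_distrib, ← Finset.mul_sum, FPFInv.sum_apply]
      simp only [hh, Finset.sum_const, Finset.card_univ, nsmul_eq_mul, hN]
      have : N + 1 ≠ 0 := by linarith
      field_simp
    rw [h1]
    refine Submodule.sum_mem _ fun u _ => Submodule.sum_mem _ fun b _ => ?_
    split_ifs with hub
    · exact Submodule.smul_mem _ _ (Submodule.subset_span ⟨_, rfl⟩)
    · exact Submodule.zero_mem _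
  have horth : ∀ v ∈ starSpan n, inner ℝ (indicatorVec A - h) v = 0 := by
    intro v hv
    induction hv using Submodule.span_induction with
    | mem x hx =>
      obtain ⟨e, rfl⟩ := hx
      obtain ⟨a, b, hab, rfl⟩ := e.exists_mk
      rw [PiLp.inner_apply]
      have h1 : ∀ M, inner ℝ ((indicatorVec A - h) M)
          (indicatorVec (pmStar n (KEdge.mk a b hab)) M) =
          (fun π => involutionIndicator A π * ind a b π - c / N * ind a b π
            - α * (ind a b π * weight Q π)) (pmEquiv n M) := by
        intro M
        rw [indicatorVec_pmStar_mk]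
        simp [involutionIndicator, hh]
        ring
      simp only [h1]
      rw [Equiv.sum_comp (pmEquiv n) fun π => involutionIndicator A π * ind a b π
        - c / N * ind a b π - α * (ind a b π * weight Q π)]
      rw [Finset.sum_sub_distrib, Finset.sum_sub_distrib, ← Finset.mul_sum, ← Finset.mul_sum,
        sum_ind hN (by linarith) hw hab, sum_ind_mul_weight hN hN2 hw (centered_comm _)
        (centered_self _) (sum_centered hN (by linarith) hw0 hc') hab, ← hQ, hQ,
        centered_of_ne _ hab, density, hα]
      have : N - 1 ≠ 0 := by linarith
      have : N - 2 ≠ 0 := by linarith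
      field_simp
      ring
    | zero => simp
    | add x y _ _ hx hy => rw [inner_add_right, hx, hy, add_zero]
    | smul r x _ hx => rw [inner_smul_right, hx, mul_zero]
  rw [Submodule.eq_starProjection_of_mem_of_inner_eq_zero hmem horth]

/-- Densities that are close to zero or one in the weighted sense are close to the indicator of
the set where they are at least one half. -/
lemma large_density_estimates {E : Type*} [Fintype E] {p : E → ℝ} {N c s : ℝ}
    (hN : 1000 ≤ N) (hc0 : 0 < c) (hs0 : 0 ≤ s) (hs1 : s ≤ 1 / 1000) (hct : c / N ≤ 1 / 1000)
    (hp0 : ∀ e, 0 ≤ p e) (hp1 : ∀ e, p e ≤ 1) (hpc : ∀ e, p e ≤ c)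
    (h1 : ∑ e, (p e - c / N) ^ 2 * (1 - p e) ≤ 13 * c * (1 / N + c / N + s))
    (h2 : c - c * (c / N) - s ^ 2 * c ≤ ∑ e, (p e - c / N) ^ 2)
    (h3 : ∑ e, (p e - c / N) ^ 2 ≤ c * (1 + 2 / N)) :
    ∃ Z : Finset E, |(Z.card : ℝ) - c| ≤ 1400 * c ^ 2 * (s + 1 / N) ∧
      ∑ e ∈ Z, (1 - p e) ≤ 1400 * c ^ 2 * (s + 1 / N) ∧ (Z.card : ℝ) ≤ 32 * c := by
  classical
  have hNp : 0 < N := by linarith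
  have hν : 1 / N ≤ 1 / 1000 := by rw [div_le_div_iff₀ hNp (by norm_num)]; linarith
  have hν0 : 0 < 1 / N := by positivity
  have e2N : 2 / N = 2 * (1 / N) := by ring
  have ecN : c / N = c * (1 / N) := by ring
  rw [e2N] at h3
  have ht0 : 0 ≤ c / N := by positivity
  have hs2 : s ^ 2 ≤ s := by rw [pow_two]; exact mul_le_of_le_one_left hs0 (by linarith)
  set ν := 1 / N with hνdef
  set t := c / N with ht
  set S := ∑ e, (p e - t) ^ 2 with hS
  have hcs := mul_le_mul_of_nonneg_left hs2 hc0.le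
  have hcs1 := mul_le_mul_of_nonneg_left hs1 hc0.le
  have hct1 := mul_le_mul_of_nonneg_left hct hc0.le
  have hcν1 := mul_le_mul_of_nonneg_left hν hc0.le
  have hc12 : 1 / 2 ≤ c := by
    by_contra hlt
    push Not at hlt
    have h4 : (1 / 2) * S ≤ ∑ e, (p e - t) ^ 2 * (1 - p e) := by
      rw [hS, Finset.mul_sum]
      refine Finset.sum_le_sum fun e _ => ?_
      have := hpc e
      rw [mul_comm]
      exact mul_le_mul_of_nonneg_left (by linarith) (sq_nonneg _)
    linarith
  have hcc : c ≤ 2 * c ^ 2 := by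
    linear_combination 2 * mul_le_mul_of_nonneg_left hc12 hc0.le
  set X := c ^ 2 * (s + ν) with hX
  have hXc1 : c * t ≤ c ^ 2 * ν := by rw [ecN]; linarith
  have hXc2 : c * ν ≤ 2 * (c ^ 2 * ν) := by
    linear_combination mul_le_mul_of_nonneg_right hcc hν0.le
  have hXc3 : c * s ≤ 2 * (c ^ 2 * s) := by
    linear_combination mul_le_mul_of_nonneg_right hcc hs0
  have hXe : X = c ^ 2 * s + c ^ 2 * ν := by rw [hX]; ring
  have hX1 : 0 ≤ c ^ 2 * s := by positivity
  have hX2 : 0 ≤ c ^ 2 * ν := by positivity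
  set err := ∑ e, (p e - t) ^ 2 * (1 - p e) with herr
  have herrX : err ≤ 39 * X := by linarith
  set Z : Finset E := Finset.univ.filter fun e => 1 / 2 ≤ p e with hZ
  have hsplit : ∀ F : E → ℝ, ∑ e ∈ Z, F e + ∑ e ∈ Zᶜ, F e = ∑ e, F e := fun F =>
    Finset.sum_add_sum_compl Z F
  have hterm : ∀ e, 0 ≤ (p e - t) ^ 2 * (1 - p e) := fun e =>
    mul_nonneg (sq_nonneg _) (by linarith [hp1 e])
  have hqZ : ∀ e ∈ Z, 1 / 16 ≤ (p e - t) ^ 2 := by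
    intro e he
    have he : 1 / 2 ≤ p e := by simpa [hZ] using he
    rw [show (1 / 16 : ℝ) = (1 / 4) ^ 2 by norm_num]
    exact pow_le_pow_left₀ (by norm_num) (by linarith) 2
  have hout : ∑ e ∈ Zᶜ, (p e - t) ^ 2 ≤ 2 * err := by
    rw [herr, ← hsplit, mul_add]
    have : ∑ e ∈ Zᶜ, (p e - t) ^ 2 ≤ 2 * ∑ e ∈ Zᶜ, (p e - t) ^ 2 * (1 - p e) := by
      rw [Finset.mul_sum]
      refine Finset.sum_le_sum fun e he => ?_
      have he : p e < 1 / 2 := by simpa [hZ] using he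
      linear_combination 2 * mul_le_mul_of_nonneg_left he.le (sq_nonneg (p e - t))
    have h5 : 0 ≤ ∑ e ∈ Z, (p e - t) ^ 2 * (1 - p e) := Finset.sum_nonneg fun e _ => hterm e
    linarith
  have hin : ∑ e ∈ Z, (1 - p e) ≤ 16 * err := by
    rw [herr, ← hsplit, mul_add]
    have : ∑ e ∈ Z, (1 - p e) ≤ 16 * ∑ e ∈ Z, (p e - t) ^ 2 * (1 - p e) := by
      rw [Finset.mul_sum]
      refine Finset.sum_le_sum fun e he => ?_
      linear_combination 16 * mul_le_mul_of_nonneg_right (hqZ e he)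
        (show (0 : ℝ) ≤ 1 - p e by linarith [hp1 e])
    have h5 : 0 ≤ ∑ e ∈ Zᶜ, (p e - t) ^ 2 * (1 - p e) := Finset.sum_nonneg fun e _ => hterm e
    linarith
  have hSZ : ∑ e ∈ Z, (p e - t) ^ 2 ≤ S := by
    rw [hS, ← hsplit]
    have h5 : 0 ≤ ∑ e ∈ Zᶜ, (p e - t) ^ 2 := Finset.sum_nonneg fun e _ => sq_nonneg _
    linarith
  have hk32 : (Z.card : ℝ) ≤ 32 * c := by
    have : ∑ e ∈ Z, (1 / 16 : ℝ) ≤ ∑ e ∈ Z, (p e - t) ^ 2 := Finset.sum_le_sum hqZ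
    simp only [Finset.sum_const, nsmul_eq_mul] at this
    linarith
  have hklow : c - c * t - s ^ 2 * c - 2 * err ≤ Z.card := by
    have h5 : ∑ e ∈ Z, (p e - t) ^ 2 ≤ ∑ e ∈ Z, (1 : ℝ) := by
      refine Finset.sum_le_sum fun e _ => ?_
      have := hp0 e
      have := hp1 e
      rw [sq_le_one_iff_abs_le_one, abs_le]
      constructor <;> linarith
    have h6 := hsplit fun e => (p e - t) ^ 2
    simp only [Finset.sum_const, nsmul_eq_mul, mul_one] at h5
    linarith
  have hkup : (Z.card : ℝ) ≤ S + 32 * err + 2 * (Z.card * t) := by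
    have h5 : ∑ e ∈ Z, (1 : ℝ) ≤ ∑ e ∈ Z, ((p e - t) ^ 2 + 2 * (1 - p e) + 2 * t) := by
      refine Finset.sum_le_sum fun e _ => ?_
      linear_combination sq_nonneg (p e - t - 1)
    simp only [Finset.sum_add_distrib, Finset.sum_const, nsmul_eq_mul, mul_one,
      ← Finset.mul_sum] at h5
    linarith
  have hkt := mul_le_mul_of_nonneg_right hk32 ht0
  refine ⟨Z, ?_, ?_, hk32⟩
  · rw [abs_le, mul_assoc, ← hX]
    constructor <;> linarith
  · rw [mul_assoc, ← hX]; linarith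

section SymmDiff

variable {n : ℕ}

lemma ncard_iUnion_pmStar_le (hn : 1 ≤ n) (Z : Finset (KEdge n)) :
    ((⋃ e ∈ Z, pmStar n e).ncard : ℝ) ≤ Z.card * ((2 * n - 3)‼ : ℕ) := by
  have h1 : (⋃ e ∈ Z, pmStar n e).ncard ≤ ∑ e ∈ Z, (pmStar n e).ncard :=
    Finset.set_ncard_biUnion_le Z _
  calc ((⋃ e ∈ Z, pmStar n e).ncard : ℝ) ≤ ((∑ e ∈ Z, (pmStar n e).ncard : ℕ) : ℝ) := by
        exact_mod_cast h1
    _ = _ := by push_cast; simp only [ncard_pmStar hn]; simp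

lemma ncard_symmDiff_le_add (A B C : Set (PerfMatching n)) :
    ((A ∆ C).ncard : ℝ) ≤ (A ∆ B).ncard + (B ∆ C).ncard := by
  have h : A ∆ C ⊆ A ∆ B ∪ B ∆ C := symmDiff_triangle A B C
  exact_mod_cast (Set.ncard_le_ncard h (Set.toFinite _)).trans (Set.ncard_union_le _ _)

lemma ncard_symmDiff_iUnion_pmStar_le (hn : 2 ≤ n) (A : Set (PerfMatching n))
    (Z : Finset (KEdge n)) {w c : ℝ} (hw : w = ((2 * n - 3)‼ : ℕ)) (hc : (A.ncard : ℝ) = c * w) :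
    ((A ∆ ⋃ e ∈ Z, pmStar n e).ncard : ℝ) ≤ c * w
      - 2 * ∑ e ∈ Z, ∑ M, indicatorVec A M * indicatorVec (pmStar n e) M
      + Z.card * w + Z.card ^ 2 * (w / ((2 * (n : ℝ) - 1) - 2)) := by
  classical
  set m : PerfMatching n → ℝ := fun M => ∑ e ∈ Z, indicatorVec (pmStar n e) M with hm
  set W := w / ((2 * (n : ℝ) - 1) - 2) with hW
  have hW0 : 0 ≤ W := by
    have hn' : (2 : ℝ) ≤ n := by exact_mod_cast hn
    exact div_nonneg (hw ▸ Nat.cast_nonneg _) (by linarith)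
  have hpt : ∀ M, indicatorVec (A ∆ ⋃ e ∈ Z, pmStar n e) M ≤ (indicatorVec A M - m M) ^ 2 := by
    intro M
    have hnn : ∀ e ∈ Z, 0 ≤ indicatorVec (pmStar n e) M := fun e _ => by
      rcases indicatorVec_eq_zero_or_one (pmStar n e) M with h | h <;> simp [h]
    by_cases hM : M ∈ A ∆ ⋃ e ∈ Z, pmStar n e
    · have h1 : indicatorVec (A ∆ ⋃ e ∈ Z, pmStar n e) M = 1 := indicatorVec_of_mem hM
      rw [h1]
      rcases hM with ⟨hA, hB⟩ | ⟨hB, hA⟩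
      · have h2 : m M = 0 := Finset.sum_eq_zero fun e he => by
          have : M ∉ pmStar n e := fun h => hB (Set.mem_biUnion he h)
          exact indicatorVec_of_notMem this
        rw [h2, indicatorVec_of_mem hA]; norm_num
      · obtain ⟨e, he, hMe⟩ := Set.mem_iUnion₂.1 hB
        have h2 : 1 ≤ m M := by
          have h3 := Finset.single_le_sum hnn he
          have h4 : indicatorVec (pmStar n e) M = 1 := indicatorVec_of_mem hMe
          rw [h4] at h3; exact h3
        have h5 : indicatorVec A M = 0 := indicatorVec_of_notMem hA
        rw [h5]; nlinarith
    · have h1 : indicatorVec (A ∆ ⋃ e ∈ Z, pmStar n e) M = 0 := indicatorVec_of_notMem hM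
      rw [h1]; positivity
  have hmm : ∑ M, m M ^ 2 ≤ Z.card * w + Z.card ^ 2 * W := by
    have h1 : ∀ e ∈ Z, ∀ e' ∈ Z, ∑ M, indicatorVec (pmStar n e) M * indicatorVec (pmStar n e') M ≤
        W + if e' = e then w else 0 := by
      intro e _ e' _
      by_cases h : e' = e
      · subst h
        rw [if_pos rfl]
        have : ∑ M, indicatorVec (pmStar n e') M * indicatorVec (pmStar n e') M = w := by
          rw [hw, ← ncard_pmStar (by omega) e', ← sum_indicatorVec]
          refine Finset.sum_congr rfl fun M _ => ?_
          rcases indicatorVec_eq_zero_or_one (pmStar n e') M with h | h <;> simp [h]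
        linarith
      · rw [if_neg h, add_zero, hW, hw]
        exact sum_pmStar_mul_pmStar_le hn (Ne.symm h)
    calc ∑ M, m M ^ 2 = ∑ e ∈ Z, ∑ e' ∈ Z,
          ∑ M, indicatorVec (pmStar n e) M * indicatorVec (pmStar n e') M := by
          simp only [hm, pow_two, Finset.sum_mul_sum]
          rw [Finset.sum_comm]
          exact Finset.sum_congr rfl fun e _ => Finset.sum_comm
      _ ≤ ∑ e ∈ Z, ∑ e' ∈ Z, (W + if e' = e then w else 0) :=
          Finset.sum_le_sum fun e he => Finset.sum_le_sum fun e' he' => h1 e he e' he'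
      _ = ∑ e ∈ Z, (Z.card * W + w) := by
          refine Finset.sum_congr rfl fun e he => ?_
          rw [Finset.sum_add_distrib, Finset.sum_ite_eq', if_pos he]; simp
      _ = _ := by simp; ring
  have hfm : ∑ M, indicatorVec A M * m M =
      ∑ e ∈ Z, ∑ M, indicatorVec A M * indicatorVec (pmStar n e) M := by
    simp only [hm, Finset.mul_sum]
    exact Finset.sum_comm
  have hff : ∑ M, indicatorVec A M ^ 2 = c * w := by
    rw [← hc, ← sum_indicatorVec]
    refine Finset.sum_congr rfl fun M _ => ?_
    rcases indicatorVec_eq_zero_or_one A M with h | h <;> simp [h]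
  calc _ = ∑ M, indicatorVec (A ∆ ⋃ e ∈ Z, pmStar n e) M := (sum_indicatorVec _).symm
    _ ≤ ∑ M, (indicatorVec A M - m M) ^ 2 := Finset.sum_le_sum fun M _ => hpt M
    _ = ∑ M, (indicatorVec A M ^ 2 - 2 * (indicatorVec A M * m M) + m M ^ 2) :=
        Finset.sum_congr rfl fun M _ => by ring
    _ ≤ _ := by
        rw [Finset.sum_add_distrib, Finset.sum_sub_distrib, ← Finset.mul_sum, hfm, hff]
        linarith

/-- Changing the number of stars in a union changes the union by at most that many stars. -/
lemma exists_card_eq_ncard_symmDiff_le (hn : 1 ≤ n) (Z : Finset (KEdge n)) {r : ℕ}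
    (hr : r ≤ Fintype.card (KEdge n)) :
    ∃ Z' : Finset (KEdge n), Z'.card = r ∧
      (((⋃ e ∈ Z, pmStar n e) ∆ ⋃ e ∈ Z', pmStar n e).ncard : ℝ)
        ≤ |(Z.card : ℝ) - r| * ((2 * n - 3)‼ : ℕ) := by
  classical
  have key : ∀ Z Z' : Finset (KEdge n), Z ⊆ Z' →
      (((⋃ e ∈ Z, pmStar n e) ∆ ⋃ e ∈ Z', pmStar n e).ncard : ℝ)
        ≤ |(Z.card : ℝ) - Z'.card| * ((2 * n - 3)‼ : ℕ) := by
    intro Z Z' h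
    have h1 : (⋃ e ∈ Z, pmStar n e) ∆ (⋃ e ∈ Z', pmStar n e) ⊆ ⋃ e ∈ Z' \ Z, pmStar n e := by
      rintro M (⟨h1, h2⟩ | ⟨h1, h2⟩)
      · obtain ⟨e, he, hM⟩ := Set.mem_iUnion₂.1 h1
        exact absurd (Set.mem_biUnion (h he) hM) h2
      · obtain ⟨e, he, hM⟩ := Set.mem_iUnion₂.1 h1
        refine Set.mem_iUnion₂.2 ⟨e, Finset.mem_sdiff.2 ⟨he, fun hZ => h2 ?_⟩, hM⟩
        exact Set.mem_iUnion₂.2 ⟨e, hZ, hM⟩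
    have h2 : (((⋃ e ∈ Z, pmStar n e) ∆ ⋃ e ∈ Z', pmStar n e).ncard : ℝ) ≤
        (⋃ e ∈ Z' \ Z, pmStar n e).ncard := by
      exact_mod_cast Set.ncard_le_ncard h1 (Set.toFinite _)
    refine h2.trans ((ncard_iUnion_pmStar_le hn _).trans ?_)
    refine mul_le_mul_of_nonneg_right ?_ (Nat.cast_nonneg _)
    rw [Finset.card_sdiff_of_subset h, Nat.cast_sub (Finset.card_le_card h), abs_sub_comm]
    exact le_abs_self _
  rcases le_total Z.card r with h | h
  · obtain ⟨Z', hZ, -, hc⟩ := Finset.exists_subsuperset_card_eq (Finset.subset_univ Z) h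
      (by rwa [Finset.card_univ])
    exact ⟨Z', hc, hc ▸ key Z Z' hZ⟩
  · obtain ⟨Z', hZ, hc⟩ := Finset.exists_subset_card_eq h
    refine ⟨Z', hc, ?_⟩
    have := key Z' Z hZ
    rwa [symmDiff_comm, abs_sub_comm, hc] at this

lemma le_card_kEdge (hn : 1 ≤ n) : n ≤ Fintype.card (KEdge n) := by
  have h : Fintype.card (KEdge n) = (2 * n).choose 2 := by
    rw [← SimpleGraph.edgeFinset_card, SimpleGraph.card_edgeFinset_top_eq_card_choose_two]
    simp
  rw [h, Nat.choose_two_right, mul_assoc, Nat.mul_div_cancel_left _ (by norm_num)]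
  exact Nat.le_mul_of_pos_right n (by omega)

end SymmDiff

lemma sum_indicatorVec_mul_pmStar_mk {n : ℕ} (A : Set (PerfMatching n)) {w : ℝ}
    (a b : Fin (2 * n)) (h : a ≠ b) :
    (∑ M, indicatorVec A M * indicatorVec (pmStar n (KEdge.mk a b h)) M) / w =
      FPFInv.density w (involutionIndicator A) a b := by
  rw [FPFInv.density, ← Equiv.sum_comp (pmEquiv n)]
  simp only [indicatorVec_pmStar_mk, involutionIndicator, Equiv.symm_apply_apply]

lemma sum_sq_le_of_normalizedNorm_sq_le {n : ℕ} (hn : 1 ≤ n)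
    {g : EuclideanSpace ℝ (PerfMatching n)} {N w c ε : ℝ} (hNn : N = 2 * (n : ℝ) - 1)
    (hwn : w = ((2 * n - 3)‼ : ℕ)) (h : normalizedNorm g ^ 2 ≤ ε * (c / N)) :
    ∑ M, g M ^ 2 ≤ ε * (c * w) := by
  have hn' : (1 : ℝ) ≤ n := by exact_mod_cast hn
  have hN0 : 0 < N := by linarith
  have hw0 : 0 < w := by rw [hwn]; exact_mod_cast Nat.doubleFactorial_pos _
  have hcard : (Fintype.card (PerfMatching n) : ℝ) = N * w := by
    rw [Fintype.card_congr (pmEquiv n), card_fpfInv_fin hn, hNn, hwn]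
  have h0 : 0 ≤ ∑ M, g M ^ 2 := Finset.sum_nonneg fun _ _ => sq_nonneg _
  rw [normalizedNorm, Real.sq_sqrt (mul_nonneg (by positivity) h0), hcard, one_div_mul_eq_div,
    div_le_iff₀ (by positivity)] at h
  calc _ ≤ _ := h
    _ = _ := by field_simp

open FPFInv in
/-- The structure theorem for large `n` and small relative error, before rounding. -/
theorem exists_stars_of_near_starSpan {n : ℕ} (hn : 501 ≤ n) (A : Set (PerfMatching n))
    {N w c ε : ℝ} (hNn : N = 2 * (n : ℝ) - 1) (hwn : w = ((2 * n - 3)‼ : ℕ))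
    (hc : (A.ncard : ℝ) = c * w) (hc0 : 0 < c) (hct : c / N ≤ 1 / 1000) (hε0 : 0 ≤ ε)
    (hε1 : Real.sqrt ε ≤ 1 / 1000)
    (hA : normalizedNorm (indicatorVec A - (starSpan n).starProjection (indicatorVec A)) ^ 2
      ≤ ε * (c / N)) :
    ∃ Z : Finset (KEdge n), |(Z.card : ℝ) - c| ≤ 1400 * c ^ 2 * (Real.sqrt ε + 1 / N) ∧
      ((A ∆ ⋃ e ∈ Z, pmStar n e).ncard : ℝ) ≤ 7000 * c ^ 2 * w * (Real.sqrt ε + 1 / N) := by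
  have hn' : (501 : ℝ) ≤ n := by exact_mod_cast hn
  have hN : (Fintype.card (Fin (2 * n)) : ℝ) = N + 1 := by rw [hNn]; exact card_fin_two_mul n
  have hw : (Fintype.card (FPFInv (Fin (2 * n))) : ℝ) = N * w := by
    rw [hNn, hwn]; exact card_fpfInv_fin (by omega)
  have hw0 : 0 < w := by rw [hwn]; exact_mod_cast Nat.doubleFactorial_pos _
  have hN2 : 1000 ≤ N := by linarith
  have hN0 : 0 < N := by linarith
  have hc' : ∑ π, involutionIndicator A π = c * w := by rw [sum_involutionIndicator, hc]
  have hf := involutionIndicator_eq_zero_or_one A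
  have hcN : c ≤ N / 1000 := by rw [div_le_div_iff₀ hN0 (by norm_num)] at hct; linarith
  have hD := sum_sq_le_of_normalizedNorm_sq_le (by omega) hNn hwn hA
  have hD' : ∑ π, (involutionIndicator A π - (c / N + (N - 2) / (N - 1) *
      weight (centered w (c / N) (involutionIndicator A)) π)) ^ 2 ≤ ε * (c * w) := by
    refine le_trans (le_of_eq ?_) hD
    rw [← Equiv.sum_comp (pmEquiv n)]
    refine Finset.sum_congr rfl fun M _ => ?_
    rw [PiLp.sub_apply, starProjection_indicatorVec (by omega) A hNn hwn hc M, involutionIndicator,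
      Equiv.symm_apply_apply]
  obtain ⟨h1, h2, h3⟩ := weighted_defect_le hN (by linarith) hw hw0 hf hc' hc0.le (by linarith) hε0
    (by linarith) hD'
  set p : KEdge n → ℝ := fun e => (∑ M, indicatorVec A M * indicatorVec (pmStar n e) M) / w with hp
  have hpd : ∀ a b h, p (KEdge.mk a b h) = density w (involutionIndicator A) a b := fun a b h =>
    sum_indicatorVec_mul_pmStar_mk A a b h
  have hp0 : ∀ e, 0 ≤ p e := fun e => by
    obtain ⟨a, b, h, rfl⟩ := e.exists_mk
    rw [hpd]; exact density_nonneg hw0 hf a b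
  have hp1 : ∀ e, p e ≤ 1 := fun e => by
    obtain ⟨a, b, h, rfl⟩ := e.exists_mk
    rw [hpd]; exact density_le_one hN hN0.ne' hw hw0 hf a b
  have hpc : ∀ e, p e ≤ c := fun e => by
    obtain ⟨a, b, h, rfl⟩ := e.exists_mk
    rw [hpd]; exact density_le hw0 hf hc' a b
  rw [sum_sum_eq_sum_kEdge _ (fun e => (p e - c / N) ^ 2 * (1 - p e))
    (fun a => by simp [centered_self]) (fun a b h => by rw [hpd, centered_of_ne _ h])] at h1
  have hS := sum_sum_eq_sum_kEdge
    (fun a b => centered w (c / N) (involutionIndicator A) a b ^ 2) (fun e => (p e - c / N) ^ 2)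
    (fun a => by simp [centered_self]) (fun a b h => by rw [hpd, centered_of_ne _ h])
  rw [hS] at h2 h3
  obtain ⟨Z, hZ1, hZ2, hZ3⟩ := large_density_estimates hN2 hc0 (Real.sqrt_nonneg ε) hε1 hct hp0 hp1
    hpc h1 (by rw [Real.sq_sqrt hε0]; exact h2) h3
  refine ⟨Z, hZ1, (ncard_symmDiff_iUnion_pmStar_le (by omega) A Z hwn hc).trans ?_⟩
  have hsum : ∑ e ∈ Z, ∑ M, indicatorVec A M * indicatorVec (pmStar n e) M =
      w * (Z.card - ∑ e ∈ Z, (1 - p e)) := by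
    rw [Finset.sum_sub_distrib]
    simp only [Finset.sum_const, nsmul_eq_mul, mul_one, sub_sub_cancel, Finset.mul_sum]
    refine Finset.sum_congr rfl fun e _ => ?_
    rw [hp]; field_simp
  have hk : (Z.card : ℝ) ^ 2 / (N - 2) ≤ 2048 * c ^ 2 * (1 / N) := by
    have h4 : (Z.card : ℝ) ^ 2 ≤ (32 * c) ^ 2 := pow_le_pow_left₀ (Nat.cast_nonneg _) hZ3 2
    calc (Z.card : ℝ) ^ 2 / (N - 2) ≤ (32 * c) ^ 2 / (N / 2) :=
          div_le_div₀ (by positivity) h4 (by linarith) (by linarith)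
      _ = _ := by field_simp; ring
  have hη : 2048 * c ^ 2 * (1 / N) ≤ 2048 * c ^ 2 * (Real.sqrt ε + 1 / N) :=
    mul_le_mul_of_nonneg_left (by linarith [Real.sqrt_nonneg ε]) (by positivity)
  have hkc := (abs_le.1 hZ1).1
  rw [hsum, ← hNn]
  have hfin : c - Z.card + 2 * ∑ e ∈ Z, (1 - p e) + (Z.card : ℝ) ^ 2 / (N - 2) ≤
      7000 * c ^ 2 * (Real.sqrt ε + 1 / N) := by
    have : 0 ≤ c ^ 2 * (Real.sqrt ε + 1 / N) := by positivity
    linarith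
  calc _ = w * (c - Z.card + 2 * ∑ e ∈ Z, (1 - p e) + (Z.card : ℝ) ^ 2 / (N - 2)) := by ring
    _ ≤ w * (7000 * c ^ 2 * (Real.sqrt ε + 1 / N)) := mul_le_mul_of_nonneg_left hfin hw0.le
    _ = _ := by ring

lemma round_nonneg_of_nonneg {c : ℝ} (hc : 0 ≤ c) : 0 ≤ round c := by
  rw [round_eq]; exact Int.floor_nonneg.2 (by linarith)

lemma round_le_two_mul {c : ℝ} (hc : 0 ≤ c) : (round c : ℝ) ≤ 2 * c := by
  rcases lt_or_ge c (1 / 2) with h | h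
  · rw [round_eq_zero_iff.2 ⟨by linarith, h⟩]; simpa using hc
  · have := round_le_add_half c; linarith

theorem mainTheorem3 :
    ∃ C₀ ε₀ : ℝ, 0 < C₀ ∧ 0 < ε₀ ∧
      ∀ (n : ℕ), 1 ≤ n → ∀ (A : Set (PerfMatching n)) (c ε : ℝ),
        (A.ncard : ℝ) = c * ((2 * n - 3)‼ : ℕ) →
        c ≤ (2 * (n : ℝ) - 1) / 2 →
        0 ≤ ε → ε ≤ ε₀ →
        normalizedNorm (indicatorVec A - (starSpan n).starProjection (indicatorVec A)) ^ 2
            ≤ ε * (c / (2 * (n : ℝ) - 1)) →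
        (∃ Z : Finset (KEdge n), (Z.card : ℤ) = round c ∧
          ((A ∆ (⋃ e ∈ Z, pmStar n e)).ncard : ℝ)
            ≤ C₀ * c ^ 2 * ((2 * n - 3)‼ : ℕ) * (Real.sqrt ε + 1 / (2 * (n : ℝ) - 1))) ∧
        |c - (round c : ℝ)| ≤ C₀ * c ^ 2 * (Real.sqrt ε + 1 / (2 * (n : ℝ) - 1)) := by
  obtain ⟨K, hK0, hK⟩ : ∃ K : ℝ, 1000 ≤ K ∧ ∀ n : ℕ, n ≤ 500 → ((2 * n - 1)‼ : ℝ) ≤ K := by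
    refine ⟨(1000 ! : ℕ), by exact_mod_cast Nat.self_le_factorial 1000, fun n hn => ?_⟩
    exact_mod_cast (Nat.doubleFactorial_le_factorial _).trans (Nat.factorial_le (by omega))
  refine ⟨10000 + 3 * K, (1 / 1000) ^ 2, by linarith, by norm_num, ?_⟩
  intro n hn A c ε hc hcn hε0 hε1 hA
  have hn' : (1 : ℝ) ≤ n := by exact_mod_cast hn
  have hcard := doubleFactorial_two_mul_sub_one hn
  set w : ℝ := (((2 * n - 3)‼ : ℕ) : ℝ) with hw
  set N : ℝ := 2 * (n : ℝ) - 1 with hN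
  have hw1 : 1 ≤ w := by rw [hw]; exact_mod_cast Nat.doubleFactorial_pos _
  have hw0 : 0 < w := by linarith
  have hN0 : 0 < N := by linarith
  have hc0 : 0 ≤ c := by
    have : 0 ≤ c * w := hc ▸ Nat.cast_nonneg _
    exact nonneg_of_mul_nonneg_left this hw0
  set s := Real.sqrt ε with hs
  have hs0 : 0 ≤ s := Real.sqrt_nonneg ε
  have hs1 : s ≤ 1 / 1000 := (Real.sqrt_le_left (by norm_num)).2 hε1
  have hν0 : 0 < 1 / N := by positivity
  have hη0 : 0 ≤ c ^ 2 * (s + 1 / N) := by positivity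
  set r := (round c).toNat with hr
  have hrc : (r : ℤ) = round c := Int.toNat_of_nonneg (round_nonneg_of_nonneg hc0)
  have hrR : (r : ℝ) = (round c : ℝ) := by exact_mod_cast hrc
  have hrE : r ≤ Fintype.card (KEdge n) := by
    refine le_trans ?_ (le_card_kEdge hn)
    have h1 := round_le_add_half c
    rw [← hrR] at h1
    exact_mod_cast (show (r : ℝ) ≤ n by linarith)
  by_cases hbig : 3 * c ≤ (10000 + 3 * K) * c ^ 2 * (s + 1 / N)
  · constructor
    · obtain ⟨Z, -, hZ⟩ := Finset.exists_subset_card_eq (s := (Finset.univ : Finset (KEdge n)))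
        (n := r) (by rwa [Finset.card_univ])
      refine ⟨Z, by rw [hZ, hrc], ?_⟩
      have h1 := ncard_symmDiff_le_add A ∅ (⋃ e ∈ Z, pmStar n e)
      have h2 := ncard_iUnion_pmStar_le hn Z
      have h3 := mul_le_mul_of_nonneg_right (round_le_two_mul hc0) hw0.le
      have h4 := mul_le_mul_of_nonneg_right hbig hw0.le
      rw [hZ, hrR, ← hw] at h2
      simp only [← Set.bot_eq_empty, symmDiff_bot, bot_symmDiff] at h1
      calc _ ≤ _ := h1
        _ ≤ 3 * c * w := by linarith
        _ ≤ _ := h4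
        _ = _ := by ring
    · have h1 := round_le c 0
      rw [Int.cast_zero, sub_zero, abs_of_nonneg hc0] at h1
      linarith
  · push Not at hbig
    have hcpos : 0 < c := by
      rcases hc0.lt_or_eq with h | h
      · exact h
      · rw [← h] at hbig; simp at hbig
    have hcη : (10000 + 3 * K) * (c * (s + 1 / N)) < 3 := by
      refine lt_of_mul_lt_mul_left ?_ hc0
      linarith
    have hKη : K * (c * (s + 1 / N)) < 1 := by
      have : 0 ≤ c * (s + 1 / N) := by positivity
      linarith
    have hKt : K * (c / N) < 1 := by
      refine lt_of_le_of_lt (mul_le_mul_of_nonneg_left ?_ (by linarith)) hKη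
      rw [div_eq_mul_one_div]
      exact mul_le_mul_of_nonneg_left (by linarith) hc0
    have hct : c / N ≤ 1 / 1000 := by
      have : 1000 * (c / N) ≤ K * (c / N) := mul_le_mul_of_nonneg_right hK0 (by positivity)
      linarith
    have hn501 : 501 ≤ n := by
      by_contra hlt
      have h1 := hK n (by omega)
      rw [hcard, Nat.cast_mul, Nat.cast_sub (by omega), ← hw] at h1
      push_cast at h1
      rw [← hN] at h1
      have h2 : 1 ≤ c * w := by
        have h3 : 0 < c * w := by positivity
        rw [← hc] at h3 ⊢
        exact_mod_cast h3
      have h4 : (N * w) * (c / N) ≤ K * (c / N) := mul_le_mul_of_nonneg_right h1 (by positivity)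
      have h5 : (N * w) * (c / N) = c * w := by field_simp
      linarith
    obtain ⟨Z, hZ1, hZ2⟩ := exists_stars_of_near_starSpan hn501 A hN hw hc hcpos hct hε0 hs1 hA
    rw [← hs] at hZ1 hZ2
    have hround : |c - (round c : ℝ)| ≤ 1400 * c ^ 2 * (s + 1 / N) := by
      have h1 := round_le c (Z.card : ℤ)
      rw [Int.cast_natCast, abs_sub_comm c (Z.card : ℝ)] at h1
      exact h1.trans hZ1
    have hKc : 0 ≤ K * (c ^ 2 * (s + 1 / N)) := mul_nonneg (by linarith) hη0
    refine ⟨?_, by linarith⟩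
    obtain ⟨Z', hZ', hd⟩ := exists_card_eq_ncard_symmDiff_le hn Z hrE
    refine ⟨Z', by rw [hZ', hrc], (ncard_symmDiff_le_add A (⋃ e ∈ Z, pmStar n e) _).trans ?_⟩
    have h1 : |(Z.card : ℝ) - r| ≤ 2800 * c ^ 2 * (s + 1 / N) := by
      rw [hrR]
      have := abs_sub_le (Z.card : ℝ) c (round c : ℝ)
      linarith
    have h2 := mul_le_mul_of_nonneg_right h1 hw0.le
    have h3 := mul_nonneg hη0 hw0.le
    have h4 := mul_nonneg hKc hw0.le
    rw [← hw] at hd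
    linarith
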